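/- Let $F$ be a non-Archimedean local field with ring of integers $\mathcal O$ and residue field of order $q$ and characteristic different from $2$; let $|\cdot|$ be the absolute value with $|s|=q^{-v(s)}$, $v$ the normalized valuation. Let $V$ be a finite-dimensional $F$-vector space with a non-degenerate alternating bilinear form $\langle\,,\rangle$, and let $V=X+Y$ with $X,Y$ maximal totally isotropic subspaces, $x_1,\dots,x_n$ a basis of $X$ and $y_1,\dots,y_n$ the dual basis of $Y$, $\langle x_i,y_j\rangle=\delta_{ij}$. Linear maps act on row vectors from the right, and $\mathrm{Sp}(V)=\{g\in\mathrm{GL}(V):\langle vg,wg\rangle=\langle v,w\rangle\}$; write $g=\begin{pmatrix}a&b\\c&d\end{pmatrix}$ with $a:X\to X$, $b:X\to Y$, $c:Y\to X$, $d:Y\to Y$, and $Y_g=Y/\ker c$. Let $\lambda$ be a non-trivial continuous unitary character of $F^+$, and for $s\in F^*$ let $\lambda[s](t)=\lambda(st)$. Let $d_\lambda t$ be the self-dual Haar measure on $F$, i.e. the Haar measure for which $\mathcal F_\lambda\phi(u)=\int_F\lambda(ut)\phi(t)\,d_\lambda t$ satisfies $(\mathcal F_\lambda\mathcal F_\lambda\phi)(t)=\phi(-t)$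 for all locally constant compactly supported $\phi:F\to\mathbf C$. For $0\le i\le n$ let $\tau_i\in\mathrm{Sp}(V)$ be given by $x_j\tau_i=-y_j$, $y_j\tau_i=x_j$ for $j\le i$ and $x_j\tau_i=x_j$, $y_j\tau_i=y_j$ for $j>i$; identify $Y_{\tau_i}$ with the span of $y_1,\dots,y_i$ and put $d\mu_{\lambda,\tau_i}y=\prod_{k=1}^i d_\lambda y_k$. Let $P=\{g\in\mathrm{Sp}(V):Yg=Y\}$. Every $g\in\mathrm{Sp}(V)$ with $\dim Y_g=i$ can be written $g=p_1\tau_ip_2$ with $p_1,p_2\in P$, and the Haar measure $\mu_{\lambda,g}$ on $Y_g$, given by $$\mu_{\lambda,g}(O)=|\det(p_1p_2|_Y)|^{-1/2}\,\mu_{\lambda,\tau_i}(O\,\overline{p_1}),$$ where $\overline{p_1}:Y_g\to Y_{\tau_i}$ is the isomorphism induced by $p_1$, does not depend on the choice of $p_1,p_2$. The Weil operator $W_\lambda(g)$ on the space $\mathcal S(X)$ of locally constant compactly supported functions $\phi:X\to\mathbf C$ is $$[W_\lambda(g)\phi](x)=\int_{Y_g}\lambda\!\left(\frac{\langle xa,xb\rangle-2\langle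 xb,yc\rangle+\langle yc,yd\rangle}{2}\right)\phi(xa+yc)\,d\mu_{\lambda,g}y ,\qquad x\in X.$$ For $s\in F^*$ let $f_s\in\mathrm{GL}(V)$ be $(x+y)f_s=x+sy$ ($x\in X$, $y\in Y$), and let $g^{f_s}=f_s^{-1}gf_s$, which lies in $\mathrm{Sp}(V)$ for $g\in\mathrm{Sp}(V)$. Then for all $s\in F^*$ and all $g\in\mathrm{Sp}(V)$, $$W_\lambda(g^{f_s})=W_{\lambda[s]}(g).$$ -/

import Mathlib

open MeasureTheory ValuativeRel
open scoped ENNReal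

noncomputable section

namespace WeilRep

/-! ### The local field: absolute value and self-dual Haar measures -/

section LocalField

variable {F : Type*} [Field F] [ValuativeRel F] [TopologicalSpace F] [IsNonarchimedeanLocalField F]

/-- The valuation `v(s)` of `s ≠ 0`, normalized so that a uniformizer has valuation `1`.
The value group of Mathlib's valuation is multiplicative: its generator below `1` is the value of
a uniformizer, whence the sign. -/
def ord (s : F) : ℤ :=
  -WithZero.log (IsNonarchimedeanLocalField.valueGroupWithZeroIsoInt F (valuation F s))

/-- The normalized absolute value `|s| = q ^ (-v(s))`, `|0| = 0`, with `q` the order of the residue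
class field. -/
def normAbs (s : F) : ℝ :=
  open Classical in if s = 0 then 0 else (Nat.card 𝓀[F] : ℝ) ^ (-ord s)

/-- The space of complex valued, locally constant functions of compact support. -/
def BruhatSchwartz (A : Type*) [TopologicalSpace A] : Submodule ℂ (A → ℂ) where
  carrier := {f | IsLocallyConstant f ∧ HasCompactSupport f}
  zero_mem' := ⟨IsLocallyConstant.const 0, HasCompactSupport.zero⟩
  add_mem' := fun hf hg => ⟨hf.1.add hg.1, hf.2.add hg.2⟩
  smul_mem' := fun c _ hf => ⟨hf.1.comp (fun z => c • z), hf.2.comp_left (smul_zero c)⟩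

variable [MeasurableSpace F]

/-- The Fourier transform `s ↦ ∫ ψ(st) φ(t) dt` with respect to the measure `μ = dt`. -/
def fourierTransform (ψ : AddChar F Circle) (μ : Measure F) (φ : F → ℂ) (s : F) : ℂ :=
  ∫ t, (ψ.mulShift s t : ℂ) * φ t ∂μ

/-- `μ` is a Haar measure on `F` for which Fourier inversion holds with constant `1`. -/
structure IsSelfDual (ψ : AddChar F Circle) (μ : Measure F) : Prop where
  isAddHaar : μ.IsAddHaarMeasure
  inversion : ∀ φ ∈ BruhatSchwartz F, ∀ t : F,
    fourierTransform ψ μ (fourierTransform ψ μ φ) t = φ (-t)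

/-- The self-dual Haar measure associated with `ψ`. (It exists and is unique when `ψ` is continuous
and non-trivial; for other `ψ` the value is irrelevant.) -/
def selfDualMeasure (ψ : AddChar F Circle) : Measure F :=
  open Classical in if h : ∃ μ : Measure F, IsSelfDual ψ μ then h.choose else 0

end LocalField

/-! ### Symplectic groups and complete polarizations -/

section Symplectic

variable {F : Type*} [Field F] {V : Type*} [AddCommGroup V] [Module F V]

/-- The symplectic group. Mathematically it acts on `V` from the right; here `g v` stands for `vg`,
so a product `g₁ g₂` of right operators is the composite `g₂ ∘ g₁`. -/
def Sp (ω : V →ₗ[F] V →ₗ[F] F) : Subgroup (V ≃ₗ[F] V) where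
  carrier := {g | ∀ v w, ω (g v) (g w) = ω v w}
  one_mem' := fun _ _ => rfl
  mul_mem' := fun {g h} hg hh v w => (hg (h v) (h w)).trans (hh v w)
  inv_mem' := fun {g} hg v w => by
    have h := hg (g.symm v) (g.symm w)
    simp only [LinearEquiv.apply_symm_apply] at h
    exact h.symm

/-- A decomposition `V = X + Y` into totally isotropic subspaces, with a basis `x₁, …, xₙ` of `X`
and the dual basis `y₁, …, yₙ` of `Y`. (When `ω` is non-degenerate, `X` and `Y` are automatically
maximal totally isotropic.) -/
structure Polarization (ω : V →ₗ[F] V →ₗ[F] F) (n : ℕ) where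
  X : Submodule F V
  Y : Submodule F V
  isCompl : IsCompl X Y
  isotropic_X : ∀ u ∈ X, ∀ v ∈ X, ω u v = 0
  isotropic_Y : ∀ u ∈ Y, ∀ v ∈ Y, ω u v = 0
  x : Module.Basis (Fin n) F X
  y : Module.Basis (Fin n) F Y
  dual : ∀ i j, ω (x i) (y j) = if i = j then 1 else 0

namespace Polarization

variable {ω : V →ₗ[F] V →ₗ[F] F} {n : ℕ} (D : Polarization ω n)

/-- The `X`-component of a vector. -/
def toX : V →ₗ[F] D.X := D.X.projectionOnto D.Y D.isCompl

/-- The `Y`-component of a vector. -/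
def toY : V →ₗ[F] D.Y := D.Y.projectionOnto D.X D.isCompl.symm

/-- The block `a : X → X` of `T = (a b; c d)`, acting on row vectors `(x, y)`. -/
def blockA (T : V →ₗ[F] V) : D.X →ₗ[F] D.X := D.toX ∘ₗ T ∘ₗ D.X.subtype

/-- The block `b : X → Y`. -/
def blockB (T : V →ₗ[F] V) : D.X →ₗ[F] D.Y := D.toY ∘ₗ T ∘ₗ D.X.subtype

/-- The block `c : Y → X`. -/
def blockC (T : V →ₗ[F] V) : D.Y →ₗ[F] D.X := D.toX ∘ₗ T ∘ₗ D.Y.subtype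

/-- The block `d : Y → Y`. -/
def blockD (T : V →ₗ[F] V) : D.Y →ₗ[F] D.Y := D.toY ∘ₗ T ∘ₗ D.Y.subtype

/-- The quotient `Y_T = Y / ker c`. -/
abbrev YQuot (T : V →ₗ[F] V) : Type _ := D.Y ⧸ LinearMap.ker (D.blockC T)

theorem toX_add_toY (v : V) : (D.toX v : V) + (D.toY v : V) = v :=
  Submodule.projection_add_projection_eq_self D.isCompl v

theorem toX_eq_zero_iff {v : V} : D.toX v = 0 ↔ v ∈ D.Y :=
  Submodule.projectionOnto_apply_eq_zero_iff D.isCompl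

theorem form_eq (u v : V) :
    ω u v = ω (D.toX u) (D.toY v) + ω (D.toY u) (D.toX v) := by
  conv_lhs => rw [← D.toX_add_toY u, ← D.toX_add_toY v]
  simp only [map_add, LinearMap.add_apply]
  rw [D.isotropic_X _ (D.toX u).2 _ (D.toX v).2, D.isotropic_Y _ (D.toY u).2 _ (D.toY v).2]
  ring

/-! ### The similitudes -/

/-- The similitude `f_s : x + y ↦ x + s y`. -/
def similitude (s : Fˣ) : V ≃ₗ[F] V :=
  (D.X.prodEquivOfIsCompl D.Y D.isCompl).symm ≪≫ₗ
    ((LinearEquiv.refl F D.X).prodCongr (LinearEquiv.smulOfUnit s)) ≪≫ₗ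
      D.X.prodEquivOfIsCompl D.Y D.isCompl

theorem similitude_apply (s : Fˣ) (x : D.X) (y : D.Y) :
    D.similitude s ((x : V) + (y : V)) = (x : V) + (s : F) • (y : V) := by
  have h : (D.X.prodEquivOfIsCompl D.Y D.isCompl).symm ((x : V) + (y : V)) = (x, y) := by
    rw [LinearEquiv.symm_apply_eq]; rfl
  simp only [similitude, LinearEquiv.trans_apply, h]
  rfl

theorem form_similitude (s : Fˣ) (u v : V) :
    ω (D.similitude s u) (D.similitude s v) = (s : F) * ω u v := by
  conv_lhs => rw [← D.toX_add_toY u, ← D.toX_add_toY v]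
  rw [D.similitude_apply, D.similitude_apply, D.form_eq u v]
  simp only [map_add, map_smul, LinearMap.add_apply, LinearMap.smul_apply, smul_eq_mul]
  rw [D.isotropic_X _ (D.toX u).2 _ (D.toX v).2, D.isotropic_Y _ (D.toY u).2 _ (D.toY v).2]
  ring

/-- The conjugate `g^{f_s} = f_s⁻¹ g f_s` (a product of right operators). -/
def conjSimilitude (s : Fˣ) (g : Sp ω) : Sp ω :=
  ⟨(D.similitude s).symm ≪≫ₗ (g : V ≃ₗ[F] V) ≪≫ₗ D.similitude s, fun v w => by
    have h := D.form_similitude s ((D.similitude s).symm v) ((D.similitude s).symm w)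
    simp only [LinearEquiv.apply_symm_apply] at h
    simp only [LinearEquiv.trans_apply]
    rw [D.form_similitude, h, g.2]⟩

/-! ### The elements `τ_i`, the parabolic subgroup, and factorizations `g = p₁ τ_i p₂` -/

/-- The element `τ_i` of the symplectic group: `x_j ↦ -y_j`, `y_j ↦ x_j` for the first `i`
indices `j`, and `x_j ↦ x_j`, `y_j ↦ y_j` for the others. -/
def tau (i : ℕ) : V →ₗ[F] V :=
  LinearMap.ofIsCompl D.isCompl
    (D.x.constr F fun j => if (j : ℕ) < i then -(D.y j : V) else (D.x j : V))
    (D.y.constr F fun j => if (j : ℕ) < i then (D.x j : V) else (D.y j : V))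

theorem tau_x (i : ℕ) (j : Fin n) :
    D.tau i (D.x j) = if (j : ℕ) < i then -(D.y j : V) else (D.x j : V) := by
  rw [tau, LinearMap.ofIsCompl_apply_left, Module.Basis.constr_basis]

theorem tau_y (i : ℕ) (j : Fin n) :
    D.tau i (D.y j) = if (j : ℕ) < i then (D.x j : V) else (D.y j : V) := by
  rw [tau, LinearMap.ofIsCompl_apply_right, Module.Basis.constr_basis]

/-- `τ_i` preserves the symplectic form. -/
theorem form_tau (hω : ω.IsAlt) (i : ℕ) : ω.compl₁₂ (D.tau i) (D.tau i) = ω := by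
  have hxx : ∀ j k, ω (D.x j) (D.x k) = 0 := fun j k => D.isotropic_X _ (D.x j).2 _ (D.x k).2
  have hyy : ∀ j k, ω (D.y j) (D.y k) = 0 := fun j k => D.isotropic_Y _ (D.y j).2 _ (D.y k).2
  have hyx : ∀ j k, ω (D.y j) (D.x k) = - if k = j then 1 else 0 := fun j k => by
    rw [← D.dual, hω.neg]
  let B : Module.Basis (Fin n ⊕ Fin n) F V :=
    (D.x.prod D.y).map (D.X.prodEquivOfIsCompl D.Y D.isCompl)
  refine LinearMap.ext_basis B B ?_
  have hl : ∀ j, B (Sum.inl j) = D.x j := fun j => by simp [B]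
  have hr : ∀ j, B (Sum.inr j) = D.y j := fun j => by simp [B]
  rintro (j | j) (k | k) <;>
    simp only [hl, hr, LinearMap.compl₁₂_apply, tau_x, tau_y] <;>
    split_ifs <;> simp [hxx, hyy, hyx, D.dual] <;> grind

/-- The parabolic subgroup `P` of all `g` with `Yg = Y`. -/
def parabolic : Set (Sp ω) :=
  {g | D.Y.map ((g : V ≃ₗ[F] V) : V →ₗ[F] V) = D.Y}

variable {D}

/-- The restriction `p|_Y` of an element `p` of `P`. -/
def restrictY {p : Sp ω} (hp : p ∈ D.parabolic) : D.Y ≃ₗ[F] D.Y :=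
  LinearEquiv.ofSubmodules (p : V ≃ₗ[F] V) D.Y D.Y hp

theorem apply_mem_Y_iff {p : Sp ω} (hp : p ∈ D.parabolic) {v : V} :
    (p : V ≃ₗ[F] V) v ∈ D.Y ↔ v ∈ D.Y := by
  refine ⟨fun h => ?_, fun h => ((D.restrictY hp) ⟨v, h⟩).2⟩
  have h' : (p : V ≃ₗ[F] V) v ∈ D.Y.map ((p : V ≃ₗ[F] V) : V →ₗ[F] V) := by
    rw [show D.Y.map ((p : V ≃ₗ[F] V) : V →ₗ[F] V) = D.Y from hp]; exact h
  obtain ⟨w, hw, hwv⟩ := h'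
  have : w = v := (p : V ≃ₗ[F] V).injective hwv
  exact this ▸ hw

variable (D)

/-- A factorization `g = p₁ τ_i p₂` (as right operators) with `p₁, p₂ ∈ P` and `i = dim Y_g`. -/
structure Factorization (g : Sp ω) where
  p₁ : Sp ω
  p₂ : Sp ω
  mem₁ : p₁ ∈ D.parabolic
  mem₂ : p₂ ∈ D.parabolic
  eq : ((g : V ≃ₗ[F] V) : V →ₗ[F] V) =
    ((p₂ : V ≃ₗ[F] V) : V →ₗ[F] V) ∘ₗ
      D.tau (Module.finrank F (D.YQuot ((g : V ≃ₗ[F] V) : V →ₗ[F] V))) ∘ₗ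
        ((p₁ : V ≃ₗ[F] V) : V →ₗ[F] V)

variable {D}

/-- The isomorphism `Y_g → Y_{τ_i}` induced by `p₁`. -/
def Factorization.bar {g : Sp ω} (f : D.Factorization g) :
    D.YQuot ((g : V ≃ₗ[F] V) : V →ₗ[F] V) ≃ₗ[F]
      D.YQuot (D.tau (Module.finrank F (D.YQuot ((g : V ≃ₗ[F] V) : V →ₗ[F] V)))) :=
  Submodule.Quotient.equiv _ _ (D.restrictY f.mem₁) (by
    have key : ∀ y : D.Y, y ∈ LinearMap.ker (D.blockC ((g : V ≃ₗ[F] V) : V →ₗ[F] V)) ↔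
        D.restrictY f.mem₁ y ∈ LinearMap.ker (D.blockC
          (D.tau (Module.finrank F (D.YQuot ((g : V ≃ₗ[F] V) : V →ₗ[F] V))))) := by
      intro y
      have e : ((g : V ≃ₗ[F] V) : V →ₗ[F] V) (y : V) =
          (f.p₂ : V ≃ₗ[F] V) (D.tau (Module.finrank F
            (D.YQuot ((g : V ≃ₗ[F] V) : V →ₗ[F] V))) ((f.p₁ : V ≃ₗ[F] V) (y : V))) :=
        LinearMap.congr_fun f.eq (y : V)
      have h1 : y ∈ LinearMap.ker (D.blockC ((g : V ≃ₗ[F] V) : V →ₗ[F] V)) ↔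
          ((g : V ≃ₗ[F] V) : V →ₗ[F] V) (y : V) ∈ D.Y := D.toX_eq_zero_iff
      rw [h1, e, apply_mem_Y_iff f.mem₂]
      exact D.toX_eq_zero_iff.symm
    ext z
    constructor
    · rintro ⟨y, hy, rfl⟩
      exact (key y).1 hy
    · intro hz
      refine ⟨(D.restrictY f.mem₁).symm z, (key _).2 ?_, ?_⟩
      · rwa [LinearEquiv.apply_symm_apply]
      · exact LinearEquiv.apply_symm_apply _ _)

/-- `det (p₁ p₂ |_Y)`. -/
def Factorization.detY {g : Sp ω} (f : D.Factorization g) : F :=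
  LinearMap.det ((restrictY f.mem₁ ≪≫ₗ restrictY f.mem₂ : D.Y ≃ₗ[F] D.Y) : D.Y →ₗ[F] D.Y)

end Polarization

end Symplectic

/-! ### The normalized measures and the Weil operators -/

section Weil

variable {F : Type*} [Field F] [ValuativeRel F] [TopologicalSpace F] [IsNonarchimedeanLocalField F]
  [MeasurableSpace F]
  {V : Type*} [AddCommGroup V] [Module F V] [TopologicalSpace V]
  {ω : V →ₗ[F] V →ₗ[F] F} {n : ℕ}

namespace Polarization

/-- `Y_T` carries its Borel sets, for the quotient topology. -/
instance (D : Polarization ω n) (T : V →ₗ[F] V) : MeasurableSpace (D.YQuot T) := borel _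

instance (D : Polarization ω n) (T : V →ₗ[F] V) : BorelSpace (D.YQuot T) := ⟨rfl⟩

variable (D : Polarization ω n)

/-- The measure `∏_{k ≤ i} d_ψ y_k` on `Y_{τ_i}`, which is identified with the span of
`y₁, …, y_i`. -/
def tauMeasure (ψ : AddChar F Circle) (i : ℕ) : Measure (D.YQuot (D.tau i)) :=
  (Measure.pi fun _ : {k : Fin n // (k : ℕ) < i} => selfDualMeasure ψ).map
    fun t => Submodule.Quotient.mk (∑ k, t k • D.y k.1)

variable {D}

/-- The measure `|det (p₁ p₂ |_Y)|^(-1/2) • (pullback of ∏ d_ψ y_k along p₁)` on `Y_g`. -/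
def Factorization.measure (ψ : AddChar F Circle) {g : Sp ω} (f : D.Factorization g) :
    Measure (D.YQuot ((g : V ≃ₗ[F] V) : V →ₗ[F] V)) :=
  ENNReal.ofReal (normAbs f.detY ^ (-(1 / 2) : ℝ)) • (D.tauMeasure ψ _).comap f.bar

variable (D)

/-- The normalized measure `μ_{ψ,g}` on `Y_g`, by means of some factorization of `g`. (One always
exists, and the measure does not depend on it, when `ω` is a symplectic form.) -/
def normalizedMeasure (ψ : AddChar F Circle) (g : Sp ω) :
    Measure (D.YQuot ((g : V ≃ₗ[F] V) : V →ₗ[F] V)) :=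
  open Classical in
  if h : Nonempty (D.Factorization g) then h.some.measure ψ else 0

/-- The function
`y ↦ ψ((⟨xa, xb⟩ - 2⟨xb, yc⟩ + ⟨yc, yd⟩) / 2) φ(xa + yc)` on `Y`, for `g = (a b; c d)`. -/
def preIntegrand (ψ : AddChar F Circle) (g : Sp ω) (φ : D.X → ℂ) (x : D.X) (y : D.Y) : ℂ :=
  let T : V →ₗ[F] V := ((g : V ≃ₗ[F] V) : V →ₗ[F] V)
  (ψ ((ω (D.blockA T x) (D.blockB T x) - 2 * ω (D.blockB T x) (D.blockC T y)
      + ω (D.blockC T y) (D.blockD T y)) / 2) : ℂ) * φ (D.blockA T x + D.blockC T y)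

theorem preIntegrand_congr (ψ : AddChar F Circle) (g : Sp ω) (φ : D.X → ℂ) (x : D.X) (y y' : D.Y)
    (h : y - y' ∈ LinearMap.ker (D.blockC ((g : V ≃ₗ[F] V) : V →ₗ[F] V))) :
    D.preIntegrand ψ g φ x y = D.preIntegrand ψ g φ x y' := by
  obtain ⟨k, rfl⟩ : ∃ k, y = y' + k := ⟨y - y', by abel⟩
  rw [add_sub_cancel_left] at h
  set T : V →ₗ[F] V := ((g : V ≃ₗ[F] V) : V →ₗ[F] V) with hT
  have hk : D.blockC T k = 0 := h
  have hc : D.blockC T (y' + k) = D.blockC T y' := by rw [map_add, hk, add_zero]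
  have hinv : ω (T (y' : V)) (T (k : V)) = 0 := by
    rw [show ω (T (y' : V)) (T (k : V)) = ω (y' : V) (k : V) from g.2 _ _]
    exact D.isotropic_Y _ y'.2 _ k.2
  have hz : ω (D.blockC T y' : V) (D.blockD T k : V) = 0 := by
    rw [D.form_eq] at hinv
    have hX : D.toX (T (k : V)) = 0 := hk
    rw [hX, Submodule.coe_zero, map_zero, add_zero] at hinv
    exact hinv
  have hd : ω (D.blockC T y' : V) (D.blockD T (y' + k) : V)
      = ω (D.blockC T y' : V) (D.blockD T y' : V) := by
    rw [map_add, Submodule.coe_add, map_add, hz, add_zero]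
  simp only [preIntegrand, ← hT, hc, hd]

/-- The integrand of the Weil operator, as a function on `Y_g = Y / ker c`. -/
def integrand (ψ : AddChar F Circle) (g : Sp ω) (φ : D.X → ℂ) (x : D.X) :
    D.YQuot ((g : V ≃ₗ[F] V) : V →ₗ[F] V) → ℂ :=
  Quotient.lift (D.preIntegrand ψ g φ x) fun y y' h =>
    D.preIntegrand_congr ψ g φ x y y' ((Submodule.quotientRel_def _).1 h)

/-- The Weil operator `W_ψ(g)` on the Bruhat-Schwartz space of `X`, in the Schrödinger model, with
the normalized measure on `Y_g`. -/
def weil (ψ : AddChar F Circle) (g : Sp ω) (φ : BruhatSchwartz D.X) : D.X → ℂ :=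
  fun x => ∫ y, D.integrand ψ g φ x y ∂(D.normalizedMeasure ψ g)

end Polarization

end Weil

end WeilRep

end

namespace WeilRep

/-! ### Topology of the field and the modulus of multiplication -/

section LocalField

variable {F : Type*} [Field F] [ValuativeRel F] [TopologicalSpace F] [IsNonarchimedeanLocalField F]

open IsNonarchimedeanLocalField

/-! Conjugation by `f_s` turns the blocks `(a, b; c, d)` of `g` into `(a, sb; s⁻¹c, d)`. After the
substitution `y ↦ sy`, an isomorphism of `Y_g` onto the quotient of the conjugate, `yc` is unchanged
while `xb` and `yd` acquire a factor `s`. Each term of the exponent contains exactly one of these,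
so `λ` of the new exponent is `λ[s]` of the old one (`preIntegrand_conjSimilitude`).

What remains is that `y ↦ sy` carries the measure for `λ[s]` and `g` to the measure for `λ` and the
conjugate (`map_scaleYQuot_normalizedMeasure`). Let `m` be the number of coordinates on the
quotient. The self-dual measure of `λ[s]` is `|s|^(1/2)` times that of `λ`, which contributes
`|s|^(m/2)`; pushing forward along `s` contributes `|s|^(-m)`. On the other side, as right operators
`f_s⁻¹ τ_i f_s = τ_i d`, where `d` is diagonal in `P` with `det (d|_Y) = s^m`. So a factorization of
`g` yields one of the conjugate whose determinant is multiplied by `s^m`, which contributes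
`|s|^(-m/2)`. The two sides agree.

As the measure is defined through a chosen factorization, its independence of the choice is needed
(`Factorization.measure_eq_measure`). It rests on `det_sq_mul_det_restrictY` and on the change of
variables by `|det|` for product Haar measures (`map_matrix_pi`). -/

theorem countable_valueGroupWithZero : Countable (ValueGroupWithZero F) :=
  (valueGroupWithZeroIsoInt F).toEquiv.countable_iff.2 (inferInstanceAs (Countable (Option ℤ)))

instance sigmaCompactSpace_localField : SigmaCompactSpace F := by
  have := countable_valueGroupWithZero (F := F)
  refine SigmaCompactSpace_iff_exists_compact_covering.2 ?_
  obtain ⟨f, hf⟩ := exists_surjective_nat (ValueGroupWithZero F)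
  refine ⟨fun n => {x | valuation F x ≤ f n}, fun n => isCompact_closedBall F _, ?_⟩
  refine Set.eq_univ_of_forall fun x => ?_
  obtain ⟨n, hn⟩ := hf (valuation F x)
  exact Set.mem_iUnion.2 ⟨n, hn.ge⟩

/-- Balls of countably many radii make the uniformity countably generated; σ-compactness does the
rest. It is needed so that the Borel sets of `F^ι` form the product σ-algebra. -/
instance secondCountableTopology_localField : SecondCountableTopology F := by
  have := countable_valueGroupWithZero (F := F)
  let := IsTopologicalAddGroup.rightUniformSpace F
  have := isUniformAddGroup_of_addCommGroup (G := F)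
  have h : (nhds (0 : F)).IsCountablyGenerated :=
    Filter.HasCountableBasis.isCountablyGenerated
      ⟨IsValuativeTopology.hasBasis_nhds_zero' F, Set.to_countable _⟩
  have := IsUniformAddGroup.uniformity_countably_generated (α := F)
  infer_instance

variable (F) in
theorem exists_uniformizer : ∃ ϖ : F, ϖ ≠ 0 ∧
    valueGroupWithZeroIsoInt F (valuation F ϖ) = WithZero.exp (-1) := by
  obtain ⟨ϖ, h⟩ := valuation_surjective ((valueGroupWithZeroIsoInt F).symm (WithZero.exp (-1)))
  have h' : valueGroupWithZeroIsoInt F (valuation F ϖ) = WithZero.exp (-1) := by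
    rw [h, OrderMonoidIso.apply_symm_apply]
  refine ⟨ϖ, ?_, h'⟩
  rintro rfl
  rw [map_zero, map_zero] at h'
  exact WithZero.exp_ne_zero h'.symm

theorem valueGroupWithZeroIsoInt_valuation_ne_zero {a : F} (ha : a ≠ 0) :
    valueGroupWithZeroIsoInt F (valuation F a) ≠ 0 := by
  simpa using ha

theorem ord_mul {a b : F} (ha : a ≠ 0) (hb : b ≠ 0) : ord (a * b) = ord a + ord b := by
  rw [ord, ord, ord, map_mul, map_mul,
    WithZero.log_mul (valueGroupWithZeroIsoInt_valuation_ne_zero ha)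
      (valueGroupWithZeroIsoInt_valuation_ne_zero hb)]
  ring

theorem normAbs_of_ne_zero {a : F} (ha : a ≠ 0) :
    normAbs a = (Nat.card 𝓀[F] : ℝ) ^ (-ord a) := if_neg ha

theorem card_residueField_pos : (0 : ℝ) < Nat.card 𝓀[F] := by
  exact_mod_cast Nat.card_pos

theorem normAbs_one : normAbs (1 : F) = 1 := by
  simp [normAbs, ord]

theorem normAbs_mul (a b : F) : normAbs (a * b) = normAbs a * normAbs b := by
  by_cases ha : a = 0
  · simp [normAbs, ha]
  by_cases hb : b = 0
  · simp [normAbs, hb]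
  rw [normAbs_of_ne_zero ha, normAbs_of_ne_zero hb, normAbs_of_ne_zero (mul_ne_zero ha hb),
    ord_mul ha hb, neg_add, zpow_add₀ card_residueField_pos.ne']

theorem normAbs_pos {a : F} (ha : a ≠ 0) : 0 < normAbs a := by
  rw [normAbs_of_ne_zero ha]
  exact zpow_pos card_residueField_pos _

variable (F) in
/-- The normalized absolute value as a homomorphism. -/
noncomputable def normAbsHom : F →*₀ ℝ where
  toFun := normAbs
  map_zero' := if_pos rfl
  map_one' := normAbs_one
  map_mul' := normAbs_mul

theorem normAbs_inv (a : F) : normAbs a⁻¹ = (normAbs a)⁻¹ := map_inv₀ (normAbsHom F) a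

theorem normAbs_pow (a : F) (k : ℕ) : normAbs (a ^ k) = normAbs a ^ k := map_pow (normAbsHom F) a k

theorem isOpen_integer : IsOpen {x : F | valuation F x ≤ 1} := by
  let := IsTopologicalAddGroup.rightUniformSpace F
  have := isUniformAddGroup_of_addCommGroup (G := F)
  exact Valued.isOpen_integer F

/-- The value group is discrete, so a value below `1` is at most that of a uniformizer. Thus the
preimage of the integers under `ϖ⁻¹` is the maximal ideal. -/
theorem valuation_inv_mul_le_one_iff {ϖ : F}
    (h : valueGroupWithZeroIsoInt F (valuation F ϖ) = WithZero.exp (-1)) (x : F) :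
    valuation F (ϖ⁻¹ * x) ≤ 1 ↔ valuation F x < 1 := by
  by_cases hx : x = 0
  · simp [hx]
  rw [← map_le_map_iff (valueGroupWithZeroIsoInt F), ← map_lt_map_iff (valueGroupWithZeroIsoInt F),
    map_one, map_mul, map_mul, map_inv₀, map_inv₀, h,
    ← WithZero.exp_log (valueGroupWithZeroIsoInt_valuation_ne_zero hx), ← WithZero.exp_zero,
    ← WithZero.exp_neg, ← WithZero.exp_add, WithZero.exp_le_exp, WithZero.exp_lt_exp]
  omega

theorem isOpen_maximalIdeal : IsOpen {x : F | valuation F x < 1} := by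
  obtain ⟨ϖ, hϖ, h⟩ := exists_uniformizer F
  simp only [← valuation_inv_mul_le_one_iff h]
  exact isOpen_integer.preimage (continuous_const_mul ϖ⁻¹)

theorem residue_eq_residue_iff (x y : 𝒪[F]) :
    IsLocalRing.residue 𝒪[F] x = IsLocalRing.residue 𝒪[F] y ↔ valuation F (x - y : F) < 1 := by
  rw [← sub_eq_zero, ← map_sub, IsLocalRing.residue_eq_zero_iff, IsLocalRing.mem_maximalIdeal,
    mem_nonunits_iff, (Valuation.integer.integers (valuation F)).isUnit_iff_valuation_eq_one,
    lt_iff_le_and_ne]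
  exact ⟨fun h => ⟨(x - y).2, h⟩, fun h => h.2⟩

variable [MeasurableSpace F] [BorelSpace F]

/-- The ring of integers is the disjoint union of the cosets of its maximal ideal, indexed by the
residue field, and all cosets have the same measure. -/
theorem measure_integer (μ : Measure F) [μ.IsAddLeftInvariant] :
    μ {x | valuation F x ≤ 1} = Nat.card 𝓀[F] * μ {x | valuation F x < 1} := by
  let lift : 𝓀[F] → 𝒪[F] := Function.surjInv IsLocalRing.residue_surjective
  have hlift : ∀ r, IsLocalRing.residue 𝒪[F] (lift r) = r :=
    Function.surjInv_eq IsLocalRing.residue_surjective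
  let f : 𝓀[F] → Set F := fun r => (fun x => -(lift r : F) + x) ⁻¹' {x | valuation F x < 1}
  have hf : ∀ r (x : F), x ∈ f r ↔ ∃ h : x ∈ 𝒪[F], IsLocalRing.residue 𝒪[F] ⟨x, h⟩ = r := by
    intro r x
    have hx : x ∈ f r ↔ valuation F (x - lift r : F) < 1 := by
      simp only [f, Set.mem_preimage, Set.mem_ofPred_eq, neg_add_eq_sub]
    rw [hx]
    constructor
    · intro h
      have hx' : x ∈ 𝒪[F] := by
        rw [← sub_add_cancel x (lift r : F)]
        exact 𝒪[F].add_mem (show (valuation F) _ ≤ 1 from h.le) (lift r).2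
      refine ⟨hx', ?_⟩
      rw [← hlift r]
      exact (residue_eq_residue_iff ⟨x, hx'⟩ (lift r)).2 h
    · rintro ⟨hx', h⟩
      rw [← hlift r] at h
      exact (residue_eq_residue_iff ⟨x, hx'⟩ (lift r)).1 h
  have hU : {x | valuation F x ≤ 1} = ⋃ r, f r := by
    ext x
    simp only [Set.mem_iUnion, hf]
    exact ⟨fun h => ⟨_, h, rfl⟩, fun ⟨_, h, _⟩ => h⟩
  rw [hU, measure_iUnion]
  · simp only [f, measure_preimage_add, ENNReal.tsum_const, ENat.card_eq_coe_natCard]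
    simp
  · refine fun r s hrs => Set.disjoint_left.2 fun x hr hs => hrs ?_
    obtain ⟨_, h⟩ := (hf _ _).1 hr
    obtain ⟨_, h'⟩ := (hf _ _).1 hs
    exact h.symm.trans h'
  · exact fun r => (isOpen_maximalIdeal.preimage (continuous_const_add _)).measurableSet

/-- By uniqueness of Haar measure the pushforward is a multiple of `μ`; the constant can be read off
on the ring of integers, whose measure is positive and finite. -/
theorem map_mul_left_eq_smul_of_apply_integer (μ : Measure F) [μ.IsAddHaarMeasure] {a : F}
    (ha : a ≠ 0) (c : ℝ≥0∞)
    (h : μ {x | valuation F (a * x) ≤ 1} = c * μ {x | valuation F x ≤ 1}) :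
    μ.map (a * ·) = c • μ := by
  have : (μ.map (a * ·)).IsAddHaarMeasure :=
    (AddEquiv.mk (Equiv.mulLeft₀ a ha) (mul_add a)).isAddHaarMeasure_map μ
      (continuous_const_mul a) (continuous_const_mul a⁻¹)
  have hu := Measure.isAddLeftInvariant_eq_smul (μ.map (a * ·)) μ
  have h1 := congrArg (fun ν : Measure F => ν {x | valuation F x ≤ 1}) hu
  rw [hu]
  simp only [Measure.smul_apply] at h1
  rw [Measure.map_apply (measurable_const_mul a) isOpen_integer.measurableSet] at h1
  have h0 : μ {x | valuation F x ≤ 1} ≠ 0 := (isOpen_integer.measure_pos μ ⟨0, by simp⟩).ne'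
  have ht : μ {x | valuation F x ≤ 1} ≠ ∞ := (isCompact_closedBall F 1).measure_lt_top.ne
  have h2 := h1.symm.trans h
  rw [← (ENNReal.mul_left_inj h0 ht).1 h2]
  rfl

/-- Multiplication by `a` scales the Haar measures by the normalized absolute value of `a`. -/
theorem map_mul_left_haar (μ : Measure F) [μ.IsAddHaarMeasure] {a : F} (ha : a ≠ 0) :
    μ.map (a * ·) = ENNReal.ofReal (normAbs a)⁻¹ • μ := by
  -- The units obeying the scaling law form a subgroup, so it suffices to treat a uniformizer and
  -- the units of valuation `0`.
  let H : Subgroup Fˣ :=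
    { carrier := {a | μ.map ((a : F) * ·) = ENNReal.ofReal (normAbs (a : F))⁻¹ • μ}
      one_mem' := by simp [normAbs_one]
      mul_mem' := fun {a b} h h' => by
        rw [Set.mem_ofPred_eq] at h h' ⊢
        have : (((a * b : Fˣ) : F) * ·) = ((a : F) * ·) ∘ ((b : F) * ·) := by
          ext; simp [mul_assoc]
        rw [this, ← Measure.map_map (measurable_const_mul _) (measurable_const_mul _), h',
          Measure.map_smul, h, smul_smul, Units.val_mul, normAbs_mul, mul_inv, mul_comm (normAbs _)⁻¹,
          ENNReal.ofReal_mul (inv_nonneg.2 (normAbs_pos b.ne_zero).le)]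
      inv_mem' := fun {a} h => by
        rw [Set.mem_ofPred_eq] at h ⊢
        have h1 := congrArg (Measure.map (((a⁻¹ : Fˣ) : F) * ·)) h
        rw [Measure.map_map (measurable_const_mul _) (measurable_const_mul _),
          Measure.map_smul] at h1
        have : (((a⁻¹ : Fˣ) : F) * ·) ∘ ((a : F) * ·) = id := by ext; simp
        rw [this, Measure.map_id] at h1
        conv_rhs => rw [h1]
        rw [smul_smul, ← ENNReal.ofReal_mul (inv_nonneg.2 (normAbs_pos a⁻¹.ne_zero).le), ← mul_inv,
          ← normAbs_mul]
        simp [normAbs_one] }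
  obtain ⟨ϖ, hϖ, h⟩ := exists_uniformizer F
  have hord : ord ϖ = 1 := by rw [ord, h, WithZero.log_exp, neg_neg]
  have hϖH : Units.mk0 ϖ hϖ ∈ H := by
    -- It is `ϖ⁻¹` whose preimage of the integers is the maximal ideal, with measure `1/q` of the
    -- whole.
    rw [← inv_inv (Units.mk0 ϖ hϖ)]
    refine H.inv_mem ?_
    refine map_mul_left_eq_smul_of_apply_integer μ (Units.ne_zero _) _ ?_
    rw [measure_integer, Units.val_inv_eq_inv_val, Units.val_mk0]
    simp only [valuation_inv_mul_le_one_iff h]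
    rw [normAbs_inv, inv_inv, normAbs_of_ne_zero hϖ, hord, zpow_neg_one,
      ENNReal.ofReal_inv_of_pos card_residueField_pos, ENNReal.ofReal_natCast, ← mul_assoc,
      ENNReal.inv_mul_cancel (by exact_mod_cast Nat.card_pos.ne') (ENNReal.natCast_ne_top _),
      one_mul]
  have huH : ∀ u : Fˣ, ord (u : F) = 0 → u ∈ H := by
    intro u hu
    have hv : valuation F (u : F) = 1 := by
      apply EquivLike.injective (valueGroupWithZeroIsoInt F)
      rw [map_one, ← WithZero.exp_log (valueGroupWithZeroIsoInt_valuation_ne_zero u.ne_zero),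
        WithZero.exp_eq_one]
      simpa [ord] using hu
    refine map_mul_left_eq_smul_of_apply_integer μ u.ne_zero _ ?_
    simp [hv, normAbs_of_ne_zero, hu]
  have hord_hom : ∀ k : ℤ, ord (((Units.mk0 ϖ hϖ) ^ k : Fˣ) : F) = k := by
    intro k
    rw [Units.val_zpow_eq_zpow_val, Units.val_mk0, ord, map_zpow₀, map_zpow₀, WithZero.log_zpow, h,
      WithZero.log_exp]
    simp
  have key : Units.mk0 a ha ∈ H := by
    rw [← mul_inv_cancel_right (Units.mk0 a ha) (Units.mk0 ϖ hϖ ^ (-ord a)),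
      ← zpow_neg, neg_neg]
    refine H.mul_mem (huH _ ?_) (H.zpow_mem hϖH _)
    rw [Units.val_mul, ord_mul (Units.ne_zero _) (Units.ne_zero _), hord_hom]
    simp
  exact key
end LocalField

/-! ### Self-dual measures and shifts of the character -/

section SelfDual

variable {F : Type*} [Field F] [ValuativeRel F] [TopologicalSpace F] [IsNonarchimedeanLocalField F]
  [MeasurableSpace F]

theorem fourierTransform_smul_measure (ψ : AddChar F Circle) (μ : Measure F) (c : ℝ≥0∞)
    (φ : F → ℂ) (u : F) :
    fourierTransform ψ (c • μ) φ u = c.toReal * fourierTransform ψ μ φ u := by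
  rw [fourierTransform, integral_smul_measure, Complex.real_smul, fourierTransform]

theorem fourierTransform_const_mul (ψ : AddChar F Circle) (μ : Measure F) (c : ℂ)
    (φ : F → ℂ) (u : F) :
    fourierTransform ψ μ (fun t => c * φ t) u = c * fourierTransform ψ μ φ u := by
  simp only [fourierTransform, ← integral_const_mul]
  congr! 2
  ring

theorem fourierTransform_fourierTransform_smul_measure (ψ : AddChar F Circle) (μ : Measure F)
    (c : ℝ≥0∞) (φ : F → ℂ) (u : F) :
    fourierTransform ψ (c • μ) (fourierTransform ψ (c • μ) φ) u =
      c.toReal ^ 2 * fourierTransform ψ μ (fourierTransform ψ μ φ) u := by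
  rw [funext (fourierTransform_smul_measure ψ μ c φ), fourierTransform_smul_measure,
    fourierTransform_const_mul, sq, mul_assoc]

theorem fourierTransform_mulShift (ψ : AddChar F Circle) (μ : Measure F) (s : F)
    (φ : F → ℂ) (u : F) :
    fourierTransform (ψ.mulShift s) μ φ u = fourierTransform ψ μ φ (s * u) := by
  simp only [fourierTransform, AddChar.mulShift_apply, mul_assoc]

variable [BorelSpace F]

theorem measurableEmbedding_mul_left {a : F} (ha : a ≠ 0) : MeasurableEmbedding (a * ·) :=
  (Homeomorph.mulLeft₀ a ha).measurableEmbedding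

theorem integral_comp_mul_left (μ : Measure F) [μ.IsAddHaarMeasure] {a : F} (ha : a ≠ 0)
    (f : F → ℂ) : ∫ t, f (a * t) ∂μ = ((normAbs a)⁻¹ : ℝ) * ∫ t, f t ∂μ := by
  rw [← (measurableEmbedding_mul_left ha).integral_map, map_mul_left_haar μ ha,
    integral_smul_measure, ENNReal.toReal_ofReal (inv_nonneg.2 (normAbs_pos ha).le),
    Complex.real_smul]

/-- The inner transform for the shifted character is the old one at `st`; substituting `st` for `t`
in the outer integral absorbs the outer shift too and costs `|s|⁻¹`. -/
theorem fourierTransform_fourierTransform_mulShift (ψ : AddChar F Circle) (μ : Measure F)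
    [μ.IsAddHaarMeasure] (s : Fˣ) (φ : F → ℂ) (u : F) :
    fourierTransform (ψ.mulShift s) μ (fourierTransform (ψ.mulShift s) μ φ) u =
      ((normAbs (s : F))⁻¹ : ℝ) * fourierTransform ψ μ (fourierTransform ψ μ φ) u := by
  rw [funext (fourierTransform_mulShift ψ μ s φ), fourierTransform, fourierTransform,
    ← integral_comp_mul_left μ s.ne_zero]
  simp only [AddChar.mulShift_apply, mul_left_comm u]

/-- The measure enters the double transform twice, so the factor `|s|^(1/2)` contributes `|s|`,
cancelling the `|s|⁻¹` caused by the shift. -/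
theorem IsSelfDual.mulShift {ψ : AddChar F Circle} {μ : Measure F} (h : IsSelfDual ψ μ) (s : Fˣ) :
    IsSelfDual (ψ.mulShift (s : F))
      (ENNReal.ofReal (normAbs (s : F) ^ (1 / 2 : ℝ)) • μ) := by
  have := h.isAddHaar
  have hs := normAbs_pos s.ne_zero
  refine ⟨Measure.IsAddHaarMeasure.smul μ ?_ ENNReal.ofReal_ne_top, fun φ hφ t => ?_⟩
  · exact (ENNReal.ofReal_pos.2 (Real.rpow_pos_of_pos hs _)).ne'
  · rw [fourierTransform_fourierTransform_smul_measure, fourierTransform_fourierTransform_mulShift,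
      h.inversion φ hφ, ENNReal.toReal_ofReal (Real.rpow_nonneg hs.le _), ← mul_assoc,
      ← Complex.ofReal_pow, ← Complex.ofReal_mul, ← Real.rpow_natCast, ← Real.rpow_mul hs.le]
    norm_num
    rw [mul_inv_cancel₀ (by exact_mod_cast hs.ne'), one_mul]

variable (F) in
theorem exists_bruhatSchwartz_apply_zero_ne_zero : ∃ φ ∈ BruhatSchwartz F, φ 0 ≠ 0 := by
  have hc : IsClopen {x : F | valuation F x ≤ 1} := by
    let := IsTopologicalAddGroup.rightUniformSpace F
    have := isUniformAddGroup_of_addCommGroup (G := F)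
    exact Valued.isClopen_integer F
  refine ⟨Set.indicator {x : F | valuation F x ≤ 1} 1, ⟨?_, ?_⟩, by simp⟩
  · rw [← LocallyConstant.coe_charFn ℂ hc]
    exact (LocallyConstant.charFn ℂ hc).isLocallyConstant
  refine HasCompactSupport.intro' (IsNonarchimedeanLocalField.isCompact_closedBall F 1) hc.isClosed ?_
  exact fun x hx => Set.indicator_of_notMem hx _

/-- If `μ = cν`, the double transforms differ by `c²`; one test function nonzero at `0` forces `c² =
1`, hence `c = 1`. -/
theorem IsSelfDual.unique {ψ : AddChar F Circle} {μ ν : Measure F} (h : IsSelfDual ψ μ)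
    (h' : IsSelfDual ψ ν) : μ = ν := by
  have := h.isAddHaar
  have := h'.isAddHaar
  have hu := Measure.isAddLeftInvariant_eq_smul μ ν
  set c := Measure.addHaarScalarFactor μ ν
  obtain ⟨φ, hφ, h0⟩ := exists_bruhatSchwartz_apply_zero_ne_zero F
  have h1 := h.inversion φ hφ 0
  rw [hu, show c • ν = (c : ℝ≥0∞) • ν from rfl, fourierTransform_fourierTransform_smul_measure,
    h'.inversion φ hφ, neg_zero, mul_eq_right₀ h0] at h1
  have h2 : c = 1 := by
    rw [ENNReal.coe_toReal] at h1
    have h3 : (c : ℝ) ^ 2 = 1 := by exact_mod_cast h1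
    exact NNReal.coe_eq_one.1 ((pow_eq_one_iff_of_nonneg c.2 two_ne_zero).1 h3)
  rw [hu, h2, one_smul]

theorem selfDualMeasure_eq {ψ : AddChar F Circle} {μ : Measure F} (h : IsSelfDual ψ μ) :
    selfDualMeasure ψ = μ := by
  have h' : ∃ μ : Measure F, IsSelfDual ψ μ := ⟨μ, h⟩
  rw [selfDualMeasure, dif_pos h']
  exact h'.choose_spec.unique h

theorem selfDualMeasure_eq_zero {ψ : AddChar F Circle} (h : ¬ ∃ μ : Measure F, IsSelfDual ψ μ) :
    selfDualMeasure ψ = 0 := dif_neg h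

theorem selfDualMeasure_mulShift (ψ : AddChar F Circle) (s : Fˣ) :
    selfDualMeasure (ψ.mulShift (s : F)) =
      ENNReal.ofReal (normAbs (s : F) ^ (1 / 2 : ℝ)) • selfDualMeasure ψ := by
  by_cases h : ∃ μ : Measure F, IsSelfDual ψ μ
  · obtain ⟨μ, h⟩ := h
    rw [selfDualMeasure_eq h, selfDualMeasure_eq (h.mulShift s)]
  -- Shifting back by `s⁻¹` shows that the shifted character has no self-dual measure either, so
  -- both sides are the default `0`.
  · rw [selfDualMeasure_eq_zero h, smul_zero]
    refine selfDualMeasure_eq_zero fun ⟨μ, hμ⟩ => h ?_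
    have := hμ.mulShift s⁻¹
    rw [AddChar.mulShift_mulShift, Units.mul_inv, AddChar.mulShift_one] at this
    exact ⟨_, this⟩

/-- The properties used below (σ-finiteness, invariance, scaling) also hold for the zero measure, so
existence of a self-dual measure need not be settled. -/
theorem selfDualMeasure_eq_zero_or_isAddHaarMeasure (ψ : AddChar F Circle) :
    selfDualMeasure ψ = 0 ∨ (selfDualMeasure ψ).IsAddHaarMeasure := by
  by_cases h : ∃ μ : Measure F, IsSelfDual ψ μ
  · obtain ⟨μ, h⟩ := h
    rw [selfDualMeasure_eq h]
    exact .inr h.isAddHaar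
  · exact .inl (selfDualMeasure_eq_zero h)

instance (ψ : AddChar F Circle) : SigmaFinite (selfDualMeasure ψ) := by
  rcases selfDualMeasure_eq_zero_or_isAddHaarMeasure ψ with h | h
  · rw [h]; infer_instance
  · infer_instance

instance (ψ : AddChar F Circle) : (selfDualMeasure ψ).IsAddLeftInvariant := by
  rcases selfDualMeasure_eq_zero_or_isAddHaarMeasure ψ with h | h
  · rw [h]; exact ⟨fun _ => by simp⟩
  · infer_instance

theorem map_mul_left_selfDualMeasure (ψ : AddChar F Circle) {a : F} (ha : a ≠ 0) :
    (selfDualMeasure ψ).map (a * ·) = ENNReal.ofReal (normAbs a)⁻¹ • selfDualMeasure ψ := by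
  rcases selfDualMeasure_eq_zero_or_isAddHaarMeasure ψ with h | h
  · simp [h]
  · exact map_mul_left_haar _ ha

end SelfDual

/-! ### Linear change of variables for product measures -/

section Pi

variable {F : Type*} [Field F] [ValuativeRel F] [TopologicalSpace F] [IsNonarchimedeanLocalField F]
  [MeasurableSpace F] [BorelSpace F] {ι : Type*} [Fintype ι] {μ : Measure F} [SigmaFinite μ]

theorem pi_eq_pow_smul {c : ℝ≥0∞} {ν : Measure F} [SigmaFinite ν] (h : ν = c • μ) :
    Measure.pi (fun _ : ι => ν) = c ^ Fintype.card ι • Measure.pi fun _ : ι => μ := by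
  refine Measure.pi_eq fun s _ => ?_
  simp [h, Measure.pi_pi, Finset.prod_mul_distrib]

open Matrix

theorem measurable_toLin' [DecidableEq ι] (M : Matrix ι ι F) : Measurable (toLin' M) :=
  (LinearMap.continuous_on_pi _).measurable

theorem map_diagonal_pi [DecidableEq ι]
    (h : ∀ a : F, a ≠ 0 → μ.map (a * ·) = ENNReal.ofReal (normAbs a)⁻¹ • μ)
    {D : ι → F} (hD : (diagonal D).det ≠ 0) :
    (Measure.pi fun _ => μ).map (toLin' (diagonal D)) =
      ENNReal.ofReal (normAbs (diagonal D).det)⁻¹ • Measure.pi fun _ => μ := by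
  rw [det_diagonal] at hD ⊢
  have hD' : ∀ i, D i ≠ 0 := fun i => Finset.prod_ne_zero_iff.1 hD i (Finset.mem_univ i)
  have hd := normAbs_pos hD
  -- Product measures are characterized by their values on boxes, so the identity is first proved
  -- solved for `Measure.pi`.
  have key : Measure.pi (fun _ => μ) = ENNReal.ofReal (normAbs (∏ i, D i)) •
      (Measure.pi fun _ => μ).map (toLin' (diagonal D)) := by
    refine Measure.pi_eq fun s hs => ?_
    rw [Measure.smul_apply, Measure.map_apply (measurable_toLin' _) (MeasurableSet.univ_pi hs)]
    have e : toLin' (diagonal D) ⁻¹' Set.pi Set.univ s =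
        Set.pi Set.univ fun i => (D i * ·) ⁻¹' s i := by
      ext t
      simp [diagonal_toLin']
    rw [e, Measure.pi_pi, show normAbs (∏ i, D i) = ∏ i, normAbs (D i) from
        map_prod (normAbsHom F) _ _, ENNReal.ofReal_prod_of_nonneg fun i _ => (normAbs_pos (hD' i)).le,
      smul_eq_mul, ← Finset.prod_mul_distrib]
    refine Finset.prod_congr rfl fun i _ => ?_
    rw [← Measure.map_apply (measurable_const_mul _) (hs i), h _ (hD' i), Measure.smul_apply,
      smul_eq_mul, ← mul_assoc, ← ENNReal.ofReal_mul (normAbs_pos (hD' i)).le,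
      mul_inv_cancel₀ (normAbs_pos (hD' i)).ne', ENNReal.ofReal_one, one_mul]
  conv_rhs => rw [key]
  rw [smul_smul, ← ENNReal.ofReal_mul (inv_nonneg.2 hd.le), inv_mul_cancel₀ hd.ne',
    ENNReal.ofReal_one, one_smul]

/-- A transvection translates one coordinate by an amount independent of it; integrating over that
coordinate first, translation invariance suffices. -/
theorem map_transvection_pi [DecidableEq ι] [μ.IsAddLeftInvariant] (t : TransvectionStruct ι F) :
    (Measure.pi fun _ => μ).map (toLin' t.toMatrix) = Measure.pi fun _ => μ := by
  have ht : Measurable (toLin' t.toMatrix) := measurable_toLin' _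
  refine (Measure.pi_eq fun s hs ↦ ?_).symm
  have h2s : MeasurableSet (Set.univ.pi s) := .pi Set.countable_univ fun i _ ↦ hs i
  simp_rw [← Measure.pi_pi, ← lintegral_indicator_one h2s]
  rw [lintegral_map (measurable_one.indicator h2s) ht]
  refine lintegral_eq_of_lmarginal_eq {t.i} ((measurable_one.indicator h2s).comp ht)
    (measurable_one.indicator h2s) ?_
  simp_rw [lmarginal_singleton]
  ext x
  cases t with | mk t_i t_j t_hij t_c =>
  simp [transvection, single_mulVec, t_hij.symm, ← Function.update_add,
    lintegral_add_right_eq_self fun xᵢ ↦ Set.indicator (Set.univ.pi s) 1 (Function.update x t_i xᵢ)]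

/-- An invertible matrix scales the product of Haar measures through the absolute value of its
determinant. -/
theorem map_matrix_pi [DecidableEq ι] [μ.IsAddLeftInvariant]
    (h : ∀ a : F, a ≠ 0 → μ.map (a * ·) = ENNReal.ofReal (normAbs a)⁻¹ • μ)
    {M : Matrix ι ι F} (hM : M.det ≠ 0) :
    (Measure.pi fun _ => μ).map (toLin' M) =
      ENNReal.ofReal (normAbs M.det)⁻¹ • Measure.pi fun _ => μ := by
  refine diagonal_transvection_induction_of_det_ne_zero (fun M => (Measure.pi fun _ => μ).map
    (toLin' M) = ENNReal.ofReal (normAbs M.det)⁻¹ • Measure.pi fun _ => μ) M hM (fun D hD => map_diagonal_pi h hD)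
    (fun t => ?_) fun A B hA hB IHA IHB => ?_
  · rw [map_transvection_pi, TransvectionStruct.det, normAbs_one, inv_one, ENNReal.ofReal_one,
      one_smul]
  · rw [toLin'_mul, det_mul, LinearMap.coe_comp,
      ← Measure.map_map (measurable_toLin' _) (measurable_toLin' _), IHB, Measure.map_smul, IHA,
      smul_smul, ← ENNReal.ofReal_mul (inv_nonneg.2 (normAbs_pos hB).le), ← mul_inv, mul_comm,
      normAbs_mul]

end Pi

namespace Polarization

/-! ### Coordinates on `Y` and the action of `τ_i` -/

section Algebra

variable {F : Type*} [Field F] {V : Type*} [AddCommGroup V] [Module F V]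
  {ω : V →ₗ[F] V →ₗ[F] F} {n : ℕ} (D : Polarization ω n)

theorem mem_parabolic_iff {g : Sp ω} :
    g ∈ D.parabolic ↔ ∀ v, (g : V ≃ₗ[F] V) v ∈ D.Y ↔ v ∈ D.Y := by
  refine ⟨fun h v => apply_mem_Y_iff h, fun h => le_antisymm ?_ fun _ hv => ?_⟩
  · rintro _ ⟨v, hv, rfl⟩
    exact (h v).2 hv
  · refine ⟨(g : V ≃ₗ[F] V).symm _, (h _).1 ?_, LinearEquiv.apply_symm_apply _ _⟩
    rwa [LinearEquiv.apply_symm_apply]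

variable {D} in
theorem mul_mem_parabolic {g h : Sp ω} (hg : g ∈ D.parabolic) (hh : h ∈ D.parabolic) :
    g * h ∈ D.parabolic :=
  D.mem_parabolic_iff.2 fun _ => (apply_mem_Y_iff hg).trans (apply_mem_Y_iff hh)

variable {D} in
theorem inv_mem_parabolic {g : Sp ω} (hg : g ∈ D.parabolic) : g⁻¹ ∈ D.parabolic :=
  D.mem_parabolic_iff.2 fun v => by
    rw [← apply_mem_Y_iff hg]
    exact iff_of_eq (congrArg (· ∈ D.Y) ((g : V ≃ₗ[F] V).apply_symm_apply v))

variable {D} in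
@[simp]
theorem coe_restrictY {p : Sp ω} (hp : p ∈ D.parabolic) (y : D.Y) :
    (D.restrictY hp y : V) = (p : V ≃ₗ[F] V) y := rfl

theorem coe_eq_sum_repr (y : D.Y) : (y : V) = ∑ k, D.y.repr y k • (D.y k : V) := by
  conv_lhs => rw [← D.y.sum_repr y]
  push_cast
  rfl

theorem form_x_Y (l : Fin n) (y : D.Y) : ω (D.x l) y = D.y.repr y l := by
  rw [D.coe_eq_sum_repr y]
  simp [D.dual]

theorem form_x_tau_Y (i : ℕ) (l : Fin n) (y : D.Y) :
    ω (D.x l) (D.tau i y) = if (l : ℕ) < i then 0 else D.y.repr y l := by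
  have h : ∀ k, ω (D.x l) (D.tau i (D.y k)) =
      if k = l then (if (l : ℕ) < i then 0 else 1) else 0 := fun k => by
    rw [tau_y]
    split_ifs <;> simp_all [D.dual, D.isotropic_X _ (D.x _).2 _ (D.x _).2, eq_comm]
  conv_lhs => rw [D.coe_eq_sum_repr y]
  simp [h]

/-- The remaining `y_k` are fixed by `τ_i` and pair to zero with `Y`. Such pairings turn symplectic
identities into identities of matrix entries. -/
theorem form_tau_Y_Y (i : ℕ) (y z : D.Y) :
    ω (D.tau i y) z = ∑ k : {k : Fin n // (k : ℕ) < i}, D.y.repr y k * D.y.repr z k := by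
  have h : ∀ k, ω (D.tau i (D.y k)) z = if (k : ℕ) < i then D.y.repr z k else 0 := fun k => by
    rw [tau_y]
    split_ifs
    · exact D.form_x_Y k z
    · exact D.isotropic_Y _ (D.y k).2 _ z.2
  conv_lhs => rw [D.coe_eq_sum_repr y]
  simp only [map_sum, map_smul, LinearMap.sum_apply, LinearMap.smul_apply, h, smul_eq_mul,
    mul_ite, mul_zero]
  rw [← Finset.sum_filter]
  exact (Finset.sum_subtype _ (by simp) _)

theorem mem_ker_blockC_iff (T : V →ₗ[F] V) (y : D.Y) :
    y ∈ LinearMap.ker (D.blockC T) ↔ T y ∈ D.Y := D.toX_eq_zero_iff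

theorem mem_ker_blockC_tau {i : ℕ} {y : D.Y} (h : ∀ k : Fin n, (k : ℕ) < i → D.y.repr y k = 0) :
    y ∈ LinearMap.ker (D.blockC (D.tau i)) := by
  rw [mem_ker_blockC_iff, D.coe_eq_sum_repr y, map_sum]
  refine Submodule.sum_mem _ fun k _ => ?_
  rw [map_smul, tau_y]
  split_ifs with hk
  · simp [h k hk]
  · exact D.Y.smul_mem _ (D.y k).2

/-! ### Parabolic elements intertwined by `τ_i` -/

section Intertwining

variable {c d : Sp ω} (hc : c ∈ D.parabolic) (hd : d ∈ D.parabolic) {i : ℕ}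

/-- The matrix of `p|_Y` in the basis `y₁, …, yₙ`. -/
noncomputable abbrev matrixY {p : Sp ω} (hp : p ∈ D.parabolic) : Matrix (Fin n) (Fin n) F :=
  LinearMap.toMatrix D.y D.y (D.restrictY hp : D.Y →ₗ[F] D.Y)

theorem matrixY_apply {p : Sp ω} (hp : p ∈ D.parabolic) (j k : Fin n) :
    D.matrixY hp j k = D.y.repr (D.restrictY hp (D.y k)) j := by
  exact LinearMap.toMatrix_apply _ _ _ _ _

variable (h : ∀ y : D.Y, (d : V ≃ₗ[F] V) (D.tau i y) = D.tau i ((c : V ≃ₗ[F] V) y))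

include hd h in
-- Pairing `y_k c τ_i = y_k τ_i d = y_k d` (right operators) with `y_j` gives the entry; it vanishes
-- because `y_k d` lies in the isotropic `Y`.
theorem matrixY_upper_eq_zero {j k : Fin n} (hj : (j : ℕ) < i) (hk : ¬ (k : ℕ) < i) :
    D.matrixY hc j k = 0 := by
  have h1 := D.form_tau_Y_Y i (D.restrictY hc (D.y k)) (D.y j)
  rw [coe_restrictY, ← h, tau_y, if_neg hk, ← coe_restrictY hd,
    D.isotropic_Y _ (D.restrictY hd (D.y k)).2 _ (D.y j).2,
    Finset.sum_eq_single ⟨j, hj⟩ (fun b _ hb => by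
      rw [D.y.repr_self, Finsupp.single_apply, if_neg (fun h => hb (Subtype.ext h.symm)), mul_zero])
      (by simp)] at h1
  rw [matrixY_apply]
  simpa using h1.symm

include h in
-- Here `y_k d = y_k c τ_i`; pairing with `x_j` reads off the coordinates.
theorem matrixY_eq_of_not_lt {j k : Fin n} (hk : ¬ (k : ℕ) < i) :
    D.matrixY hd j k = if (j : ℕ) < i then 0 else D.matrixY hc j k := by
  rw [matrixY_apply, matrixY_apply, ← form_x_tau_Y, coe_restrictY, ← h, tau_y, if_neg hk,
    ← form_x_Y, coe_restrictY]

include h in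
-- Since `d` preserves the form, `⟨y_k c τ_i, y_l d⟩ = ⟨x_k d, y_l d⟩ = δ_kl`.
theorem transpose_matrixY_mul_matrixY :
    ((D.matrixY hc).toSquareBlockProp fun k => (k : ℕ) < i).transpose *
      ((D.matrixY hd).toSquareBlockProp fun k => (k : ℕ) < i) = 1 := by
  ext k l
  have h1 := D.form_tau_Y_Y i (D.restrictY hc (D.y k)) (D.restrictY hd (D.y l))
  rw [coe_restrictY, coe_restrictY, ← h, d.2, tau_y, if_pos k.2, D.dual] at h1
  simp only [Matrix.mul_apply, Matrix.transpose_apply, Matrix.toSquareBlockProp_def, Matrix.of_apply,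
    matrixY_apply, ← h1, Matrix.one_apply, Subtype.ext_iff]

include h in
/-- If `c τ_i = τ_i d` as right operators, with `c, d` in the parabolic subgroup, then
`det (c|_{Y_{τ_i}})² det (d|_Y) = det (c|_Y)`. -/
theorem det_sq_mul_det_restrictY :
    ((D.matrixY hc).toSquareBlockProp fun k => (k : ℕ) < i).det ^ 2 *
      LinearMap.det (D.restrictY hd : D.Y →ₗ[F] D.Y) =
        LinearMap.det (D.restrictY hc : D.Y →ₗ[F] D.Y) := by
  -- Both matrices are block triangular; the upper left blocks are inverse transposes of each other
  -- and the lower right blocks coincide.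
  rw [← LinearMap.det_toMatrix D.y, ← LinearMap.det_toMatrix D.y,
    Matrix.twoBlockTriangular_det' (D.matrixY hd) (fun k => (k : ℕ) < i)
      fun j hj k hk => by rw [D.matrixY_eq_of_not_lt hc hd h hk, if_pos hj],
    Matrix.twoBlockTriangular_det' (D.matrixY hc) (fun k => (k : ℕ) < i)
      fun j hj k hk => D.matrixY_upper_eq_zero hc hd h hj hk]
  have h1 := congrArg Matrix.det (D.transpose_matrixY_mul_matrixY hc hd h)
  rw [Matrix.det_mul, Matrix.det_transpose, Matrix.det_one] at h1
  have h2 : ((D.matrixY hd).toSquareBlockProp fun k => ¬ (k : ℕ) < i) =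
      (D.matrixY hc).toSquareBlockProp fun k => ¬ (k : ℕ) < i := by
    ext j k
    exact (D.matrixY_eq_of_not_lt hc hd h k.2).trans (if_neg j.2)
  rw [h2]
  linear_combination (((D.matrixY hc).toSquareBlockProp fun k => (k : ℕ) < i).det *
    ((D.matrixY hc).toSquareBlockProp fun k => ¬ (k : ℕ) < i).det) * h1

end Intertwining

/-! ### Diagonal elements and conjugation by similitudes -/

/-- The element `x_j ↦ u_j⁻¹ x_j`, `y_j ↦ u_j y_j` of `GL(V)`. -/
noncomputable def diagonalEquiv (u : Fin n → Fˣ) : V ≃ₗ[F] V :=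
  (D.X.prodEquivOfIsCompl D.Y D.isCompl).symm ≪≫ₗ
    ((D.x.equiv (D.x.unitsSMul u⁻¹) (Equiv.refl _)).prodCongr
      (D.y.equiv (D.y.unitsSMul u) (Equiv.refl _))) ≪≫ₗ
      D.X.prodEquivOfIsCompl D.Y D.isCompl

theorem diagonalEquiv_coe_Y (u : Fin n → Fˣ) (y : D.Y) :
    D.diagonalEquiv u y = D.y.equiv (D.y.unitsSMul u) (Equiv.refl _) y := by
  simp [diagonalEquiv]

theorem diagonalEquiv_x (u : Fin n → Fˣ) (j : Fin n) :
    D.diagonalEquiv u (D.x j) = ((u j)⁻¹ : F) • (D.x j : V) := by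
  simp [diagonalEquiv, Module.Basis.unitsSMul_apply, Units.smul_def]

theorem diagonalEquiv_y (u : Fin n → Fˣ) (j : Fin n) :
    D.diagonalEquiv u (D.y j) = (u j : F) • (D.y j : V) := by
  simp [diagonalEquiv, Module.Basis.unitsSMul_apply, Units.smul_def]

/-- The basis `x₁, …, xₙ, y₁, …, yₙ` of `V`. -/
noncomputable def basis : Module.Basis (Fin n ⊕ Fin n) F V :=
  (D.x.prod D.y).map (D.X.prodEquivOfIsCompl D.Y D.isCompl)

theorem basis_inl (j : Fin n) : D.basis (Sum.inl j) = D.x j := by simp [basis]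

theorem basis_inr (j : Fin n) : D.basis (Sum.inr j) = D.y j := by simp [basis]

/-- The element `x_j ↦ u_j⁻¹ x_j`, `y_j ↦ u_j y_j` of the symplectic group. -/
noncomputable def diagonal (hω : ω.IsAlt) (u : Fin n → Fˣ) : Sp ω :=
  ⟨D.diagonalEquiv u, by
    have hxx : ∀ j k, ω (D.x j) (D.x k) = 0 := fun j k => D.isotropic_X _ (D.x j).2 _ (D.x k).2
    have hyy : ∀ j k, ω (D.y j) (D.y k) = 0 := fun j k => D.isotropic_Y _ (D.y j).2 _ (D.y k).2
    have hyx : ∀ j k, ω (D.y j) (D.x k) = - if k = j then 1 else 0 := fun j k => by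
      rw [← D.dual, hω.neg]
    have key : ω.compl₁₂ (D.diagonalEquiv u : V →ₗ[F] V) (D.diagonalEquiv u : V →ₗ[F] V) = ω := by
      refine LinearMap.ext_basis D.basis D.basis ?_
      rintro (j | j) (k | k) <;>
        simp only [basis_inl, basis_inr, LinearMap.compl₁₂_apply, LinearEquiv.coe_coe,
          diagonalEquiv_x, diagonalEquiv_y, map_smul, LinearMap.smul_apply, hxx, hyy, hyx, D.dual,
          smul_eq_mul, mul_zero] <;>
        split_ifs with hjk <;> simp [hjk]
    exact fun v w => LinearMap.congr_fun₂ key v w⟩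

theorem diagonal_mem_parabolic (hω : ω.IsAlt) (u : Fin n → Fˣ) :
    D.diagonal hω u ∈ D.parabolic := by
  refine le_antisymm ?_ fun y hy => ?_
  · rintro _ ⟨y, hy, rfl⟩
    have := D.diagonalEquiv_coe_Y u ⟨y, hy⟩
    exact this ▸ Subtype.property _
  · refine ⟨(D.y.equiv (D.y.unitsSMul u) (Equiv.refl _)).symm ⟨y, hy⟩, Subtype.property _, ?_⟩
    refine (D.diagonalEquiv_coe_Y u _).trans ?_
    rw [LinearEquiv.apply_symm_apply]

theorem det_restrictY_diagonal (hω : ω.IsAlt) (u : Fin n → Fˣ) :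
    LinearMap.det (D.restrictY (D.diagonal_mem_parabolic hω u) : D.Y →ₗ[F] D.Y) =
      ∏ j, (u j : F) := by
  rw [← LinearMap.det_toMatrix D.y]
  have : LinearMap.toMatrix D.y D.y
      (D.restrictY (D.diagonal_mem_parabolic hω u) : D.Y →ₗ[F] D.Y) =
        Matrix.diagonal fun j => (u j : F) := by
    ext j k
    have h1 : D.restrictY (D.diagonal_mem_parabolic hω u) (D.y k) = (u k : F) • D.y k :=
      Subtype.ext (D.diagonalEquiv_y u k)
    rw [LinearMap.toMatrix_apply, LinearEquiv.coe_coe, h1, Matrix.diagonal_apply]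
    simp [Finsupp.single_apply, eq_comm]
    grind
  rw [this, Matrix.det_diagonal]

theorem similitude_coe_X (s : Fˣ) (x : D.X) : D.similitude s x = x := by
  simpa using D.similitude_apply s x 0

theorem similitude_coe_Y (s : Fˣ) (y : D.Y) : D.similitude s y = (s : F) • (y : V) := by
  simpa using D.similitude_apply s 0 y

theorem similitude_symm_coe_X (s : Fˣ) (x : D.X) : (D.similitude s).symm x = x := by
  rw [LinearEquiv.symm_apply_eq, similitude_coe_X]

theorem similitude_symm_coe_Y (s : Fˣ) (y : D.Y) :
    (D.similitude s).symm y = ((s⁻¹ : Fˣ) : F) • (y : V) := by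
  rw [LinearEquiv.symm_apply_eq, map_smul, similitude_coe_Y, smul_smul, Units.inv_mul, one_smul]

theorem toX_similitude (s : Fˣ) (v : V) : D.toX (D.similitude s v) = D.toX v := by
  conv_lhs => rw [← D.toX_add_toY v, similitude_apply]
  rw [← sub_eq_zero, ← map_sub, toX_eq_zero_iff]
  nth_rewrite 3 [← D.toX_add_toY v]
  rw [add_sub_add_left_eq_sub]
  exact D.Y.sub_mem (D.Y.smul_mem _ (D.toY v).2) (D.toY v).2

theorem toY_similitude (s : Fˣ) (v : V) : D.toY (D.similitude s v) = (s : F) • D.toY v := by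
  have h := D.similitude_apply s (D.toX v) (D.toY v)
  rw [toX_add_toY, ← D.toX_add_toY (D.similitude s v), toX_similitude] at h
  exact Subtype.ext (add_left_cancel h)

theorem conjSimilitude_apply (s : Fˣ) (g : Sp ω) (v : V) :
    (D.conjSimilitude s g : V ≃ₗ[F] V) v =
      D.similitude s ((g : V ≃ₗ[F] V) ((D.similitude s).symm v)) := rfl

end Algebra

/-! ### Conjugating factorizations by a similitude -/

section Conjugation

variable {F : Type*} [Field F] {V : Type*} [AddCommGroup V] [Module F V]
  {ω : V →ₗ[F] V →ₗ[F] F} {n : ℕ} (D : Polarization ω n)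

theorem conjSimilitude_apply_coe_X (s : Fˣ) (g : Sp ω) (x : D.X) :
    (D.conjSimilitude s g : V ≃ₗ[F] V) x = D.similitude s ((g : V ≃ₗ[F] V) x) := by
  rw [conjSimilitude_apply, similitude_symm_coe_X]

theorem conjSimilitude_apply_coe_Y (s : Fˣ) (g : Sp ω) (y : D.Y) :
    (D.conjSimilitude s g : V ≃ₗ[F] V) y =
      ((s⁻¹ : Fˣ) : F) • D.similitude s ((g : V ≃ₗ[F] V) y) := by
  rw [conjSimilitude_apply, similitude_symm_coe_Y, map_smul, map_smul]

theorem similitude_mem_Y_iff (s : Fˣ) (v : V) : D.similitude s v ∈ D.Y ↔ v ∈ D.Y := by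
  rw [← toX_eq_zero_iff, toX_similitude, toX_eq_zero_iff]

theorem similitude_symm_mem_Y_iff (s : Fˣ) (v : V) : (D.similitude s).symm v ∈ D.Y ↔ v ∈ D.Y := by
  rw [← D.similitude_mem_Y_iff s, LinearEquiv.apply_symm_apply]

theorem similitude_inv (s : Fˣ) : D.similitude s⁻¹ = (D.similitude s).symm := by
  ext v
  rw [LinearEquiv.eq_symm_apply, ← D.toX_add_toY (D.similitude s (D.similitude s⁻¹ v))]
  simp [toX_similitude, toY_similitude, toX_add_toY]

theorem conjSimilitude_inv_conjSimilitude (s : Fˣ) (g : Sp ω) :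
    D.conjSimilitude s⁻¹ (D.conjSimilitude s g) = g := by
  refine Subtype.ext (LinearEquiv.ext fun v => ?_)
  rw [conjSimilitude_apply, conjSimilitude_apply, similitude_inv]
  simp

variable {D} in
theorem conjSimilitude_mem_parabolic (s : Fˣ) {p : Sp ω} (hp : p ∈ D.parabolic) :
    D.conjSimilitude s p ∈ D.parabolic :=
  D.mem_parabolic_iff.2 fun v => by
    rw [conjSimilitude_apply, similitude_mem_Y_iff, apply_mem_Y_iff hp, similitude_symm_mem_Y_iff]

/-- On `Y` the similitude is a scalar, so it commutes with `p|_Y`. -/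
theorem restrictY_conjSimilitude (s : Fˣ) {p : Sp ω} (hp : p ∈ D.parabolic) :
    D.restrictY (conjSimilitude_mem_parabolic s hp) = D.restrictY hp := by
  ext y
  rw [coe_restrictY, conjSimilitude_apply_coe_Y, ← coe_restrictY hp, similitude_coe_Y, smul_smul,
    Units.inv_mul, one_smul]

theorem restrictY_mul {p q : Sp ω} (hp : p ∈ D.parabolic) (hq : q ∈ D.parabolic) :
    D.restrictY (mul_mem_parabolic hp hq) = D.restrictY hq ≪≫ₗ D.restrictY hp := rfl

theorem restrictY_inv {p : Sp ω} (hp : p ∈ D.parabolic) :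
    D.restrictY (inv_mem_parabolic hp) = (D.restrictY hp).symm := by
  rfl

/-- The entries of the diagonal element relating `τ_i` to its conjugate by a similitude. -/
noncomputable def tauTwist (s : Fˣ) (i : ℕ) (j : Fin n) : Fˣ := if (j : ℕ) < i then s else 1

/-- The exponent counts the indices below `i`, the number of chart coordinates, so that `i ≤ n` need
not be known. -/
theorem prod_tauTwist (s : Fˣ) (i : ℕ) :
    ∏ j, (tauTwist (n := n) s i j : F) =
      (s : F) ^ Fintype.card {k : Fin n // (k : ℕ) < i} := by
  simp only [tauTwist, apply_ite Units.val, Units.val_one]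
  rw [Finset.prod_ite, Finset.prod_const_one, mul_one, Finset.prod_const, Fintype.card_subtype]

/-- As right operators, `f_s⁻¹ τ_i f_s = τ_i d` with `d` diagonal: this `d` is what changes the
determinant of a conjugated factorization. -/
theorem diagonal_tau_similitude (s : Fˣ) (i : ℕ) (v : V) :
    D.diagonalEquiv (tauTwist s i) (D.tau i (D.similitude s v)) = D.similitude s (D.tau i v) := by
  have key : (D.diagonalEquiv (tauTwist s i) : V →ₗ[F] V) ∘ₗ D.tau i ∘ₗ
      (D.similitude s : V →ₗ[F] V) = (D.similitude s : V →ₗ[F] V) ∘ₗ D.tau i := by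
    refine D.basis.ext ?_
    rintro (j | j) <;>
      simp only [basis_inl, basis_inr, LinearMap.comp_apply, LinearEquiv.coe_coe, similitude_coe_X,
        similitude_coe_Y, map_smul, tau_x, tau_y] <;>
      split_ifs with hj <;>
      simp [diagonalEquiv_x, diagonalEquiv_y, similitude_coe_X, similitude_coe_Y, tauTwist, hj]
  exact LinearMap.congr_fun key v

theorem ker_blockC_conjSimilitude (s : Fˣ) (g : Sp ω) :
    LinearMap.ker (D.blockC ((D.conjSimilitude s g : V ≃ₗ[F] V) : V →ₗ[F] V)) =
      LinearMap.ker (D.blockC ((g : V ≃ₗ[F] V) : V →ₗ[F] V)) := by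
  ext y
  rw [mem_ker_blockC_iff, mem_ker_blockC_iff, LinearEquiv.coe_coe, LinearEquiv.coe_coe,
    conjSimilitude_apply_coe_Y, D.Y.smul_mem_iff (Units.ne_zero _), similitude_mem_Y_iff]

/-- The isomorphism `y ↦ s y` of `Y_g` onto `Y_{g'}`, where `g'` is conjugate to `g` by `f_s`. -/
noncomputable def scaleYQuot (s : Fˣ) (g : Sp ω) :
    D.YQuot ((g : V ≃ₗ[F] V) : V →ₗ[F] V) ≃ₗ[F]
      D.YQuot ((D.conjSimilitude s g : V ≃ₗ[F] V) : V →ₗ[F] V) :=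
  Submodule.Quotient.equiv _ _ (LinearEquiv.smulOfUnit s) (by
    rw [ker_blockC_conjSimilitude]
    ext y
    constructor
    · rintro ⟨z, hz, rfl⟩
      exact Submodule.smul_mem _ (s : F) hz
    · intro hy
      exact ⟨((s⁻¹ : Fˣ) : F) • y, Submodule.smul_mem _ _ hy, smul_inv_smul s y⟩)

theorem finrank_YQuot_conjSimilitude (s : Fˣ) (g : Sp ω) :
    Module.finrank F (D.YQuot ((D.conjSimilitude s g : V ≃ₗ[F] V) : V →ₗ[F] V)) =
      Module.finrank F (D.YQuot ((g : V ≃ₗ[F] V) : V →ₗ[F] V)) :=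
  (D.scaleYQuot s g).finrank_eq.symm

/-- A factorization of `g` gives one of its conjugate by a similitude. -/
noncomputable def Factorization.conjSimilitude {D : Polarization ω n} (hω : ω.IsAlt) (s : Fˣ) {g : Sp ω}
    (f : D.Factorization g) : D.Factorization (D.conjSimilitude s g) where
  p₁ := D.conjSimilitude s f.p₁
  -- The product here is composition of functions: the diagonal element acts first, directly after
  -- `τ_i`.
  p₂ := D.conjSimilitude s f.p₂ * D.diagonal hω
    (tauTwist s (Module.finrank F (D.YQuot ((g : V ≃ₗ[F] V) : V →ₗ[F] V))))
  mem₁ := conjSimilitude_mem_parabolic s f.mem₁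
  mem₂ := mul_mem_parabolic (conjSimilitude_mem_parabolic s f.mem₂) (D.diagonal_mem_parabolic hω _)
  eq := by
    rw [finrank_YQuot_conjSimilitude]
    ext v
    have e := LinearMap.congr_fun f.eq ((D.similitude s).symm v)
    simp only [LinearEquiv.coe_coe, LinearMap.comp_apply] at e ⊢
    rw [conjSimilitude_apply, e]
    change _ = (D.conjSimilitude s f.p₂ : V ≃ₗ[F] V) (D.diagonalEquiv _ _)
    rw [D.conjSimilitude_apply s f.p₁, diagonal_tau_similitude, conjSimilitude_apply,
      LinearEquiv.symm_apply_apply]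

end Conjugation

/-! ### Continuity of linear maps on quotients of `Y` -/

section Topology

variable {F : Type*} [Field F] [TopologicalSpace F] [IsTopologicalRing F]
  {V : Type*} [AddCommGroup V] [Module F V] [TopologicalSpace V] [IsModuleTopology F V]
  {ω : V →ₗ[F] V →ₗ[F] F} {n : ℕ} (D : Polarization ω n)

/-- `Y` is linearly isomorphic to `V / X`, which has the module topology; the inverse is the
quotient map restricted to `Y`, so the isomorphism is a homeomorphism for the subspace topology. -/
instance isModuleTopology_Y : IsModuleTopology F D.Y := by
  have := IsModuleTopology.toContinuousAdd F V
  have := IsModuleTopology.topologicalAddGroup F V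
  let e := D.X.quotientEquivOfIsCompl D.Y D.isCompl
  refine IsModuleTopology.iso (A := V ⧸ D.X) ⟨e, ?_, ?_⟩
  · exact IsModuleTopology.continuous_of_linearMap (e : (V ⧸ D.X) →ₗ[F] D.Y)
  · change Continuous fun y => e.symm y
    simp only [e, Submodule.quotientEquivOfIsCompl_symm_apply]
    exact (IsModuleTopology.continuous_of_linearMap D.X.mkQ).comp continuous_subtype_val

theorem continuous_linearMap_YQuot {T : V →ₗ[F] V} {W : Type*} [AddCommGroup W] [Module F W]
    [TopologicalSpace W] [IsModuleTopology F W] (L : D.YQuot T →ₗ[F] W) : Continuous L := by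
  have := IsModuleTopology.toContinuousAdd F W
  exact IsModuleTopology.continuous_of_linearMap L

/-- A linear isomorphism between quotients of `Y` as a homeomorphism. -/
noncomputable def homeomorphYQuot {T T' : V →ₗ[F] V} (L : D.YQuot T ≃ₗ[F] D.YQuot T') :
    D.YQuot T ≃ₜ D.YQuot T' where
  toEquiv := L.toEquiv
  continuous_toFun := D.continuous_linearMap_YQuot (L : D.YQuot T →ₗ[F] D.YQuot T')
  continuous_invFun := D.continuous_linearMap_YQuot (L.symm : D.YQuot T' →ₗ[F] D.YQuot T)

end Topology

/-! ### Normalized measures in charts -/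

section Measures

variable {F : Type*} [Field F] [ValuativeRel F] [TopologicalSpace F] [IsNonarchimedeanLocalField F]
  [MeasurableSpace F] [BorelSpace F]
  {V : Type*} [AddCommGroup V] [Module F V] [TopologicalSpace V] [IsModuleTopology F V]
  {ω : V →ₗ[F] V →ₗ[F] F} {n : ℕ} (D : Polarization ω n)

/-- The embedding `t ↦ ∑ t_k y_k` onto the span of `y₁, …, y_i`. -/
noncomputable def spanY (i : ℕ) : ({k : Fin n // (k : ℕ) < i} → F) →ₗ[F] D.Y :=
  ∑ k, (LinearMap.proj k).smulRight (D.y k.1)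

theorem spanY_apply (i : ℕ) (t : {k : Fin n // (k : ℕ) < i} → F) :
    D.spanY i t = ∑ k, t k • D.y k.1 := by
  simp [spanY]

theorem repr_spanY (i : ℕ) (t : {k : Fin n // (k : ℕ) < i} → F)
    (j : {k : Fin n // (k : ℕ) < i}) : D.y.repr (D.spanY i t) j = t j := by
  rw [spanY_apply]
  simp [Finsupp.single_apply, ← Subtype.ext_iff]

/-- The parametrization `t ↦ (∑ t_k y_k) A⁻¹` of a quotient of `Y`. -/
noncomputable def chart (T : V →ₗ[F] V) (i : ℕ) (A : D.Y ≃ₗ[F] D.Y) :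
    ({k : Fin n // (k : ℕ) < i} → F) →ₗ[F] D.YQuot T :=
  (LinearMap.ker (D.blockC T)).mkQ ∘ₗ (A.symm : D.Y →ₗ[F] D.Y) ∘ₗ D.spanY i

theorem measurable_chart (T : V →ₗ[F] V) (i : ℕ) (A : D.Y ≃ₗ[F] D.Y) :
    Measurable (D.chart T i A) := by
  have := IsModuleTopology.toContinuousAdd F (D.YQuot T)
  exact (LinearMap.continuous_on_pi _).measurable

/-- The measure on a quotient of `Y` attached to `p₁|_Y = A` and `p₂|_Y = B`. -/
noncomputable def chartMeasure (ψ : AddChar F Circle) (T : V →ₗ[F] V) (i : ℕ) (A B : D.Y ≃ₗ[F] D.Y) :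
    Measure (D.YQuot T) :=
  ENNReal.ofReal (normAbs (LinearMap.det (A ≪≫ₗ B : D.Y →ₗ[F] D.Y)) ^ (-(1 / 2) : ℝ)) •
    (Measure.pi fun _ : {k : Fin n // (k : ℕ) < i} => selfDualMeasure ψ).map (D.chart T i A)

variable {D}

/-- Pulling back along `bar` is pushing forward along its inverse. In this form the factorization
enters only through `p₁|_Y` and `p₂|_Y`. -/
theorem Factorization.measure_eq (ψ : AddChar F Circle) {g : Sp ω} (f : D.Factorization g) :
    f.measure ψ = D.chartMeasure ψ _ (Module.finrank F (D.YQuot ((g : V ≃ₗ[F] V) : V →ₗ[F] V)))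
      (restrictY f.mem₁) (restrictY f.mem₂) := by
  set i := Module.finrank F (D.YQuot ((g : V ≃ₗ[F] V) : V →ₗ[F] V)) with hi
  let e := (D.homeomorphYQuot f.bar).toMeasurableEquiv
  have h1 : (D.tauMeasure ψ i).comap f.bar = (D.tauMeasure ψ i).map e.symm := by
    rw [e.map_symm]; rfl
  have h2 : D.tauMeasure ψ i =
      (Measure.pi fun _ => selfDualMeasure ψ).map (D.chart (D.tau i) i (LinearEquiv.refl F D.Y)) := by
    rw [tauMeasure]
    congr 1
    ext t
    rw [← spanY_apply]
    rfl
  rw [Factorization.measure, h1, h2, Measure.map_map e.symm.measurable (D.measurable_chart _ _ _)]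
  rfl

theorem rpow_neg_half_mul_inv {a b q : ℝ} (hq : 0 < q) (h : q ^ 2 * b = a) (hb : 0 < b) :
    b ^ (-(1 / 2) : ℝ) * q⁻¹ = a ^ (-(1 / 2) : ℝ) := by
  rw [← h, Real.mul_rpow (by positivity) hb.le, ← Real.rpow_natCast, ← Real.rpow_mul hq.le, mul_comm]
  norm_num
  exact .inl (Real.rpow_neg_one q).symm

theorem rpow_neg_half_mul_pow_mul_inv {b r : ℝ} (hr : 0 < r) (hb : 0 < b) (m : ℕ) :
    b ^ (-(1 / 2) : ℝ) * (r ^ (1 / 2 : ℝ)) ^ m * (r ^ m)⁻¹ = (r ^ m * b) ^ (-(1 / 2) : ℝ) := by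
  have hu : 0 < r ^ (1 / 2 : ℝ) := Real.rpow_pos_of_pos hr _
  have h : r ^ m = ((r ^ (1 / 2 : ℝ)) ^ m) ^ 2 := by
    rw [pow_right_comm, ← Real.sqrt_eq_rpow, Real.sq_sqrt hr.le]
  rw [h, ← rpow_neg_half_mul_inv (pow_pos hu m) rfl hb]
  field_simp

/-- By `hK`, only the first `i` coordinates after applying `A'` matter in the quotient, so the
change of chart is the upper left block of the matrix of `y ↦ A' (A⁻¹ y)`. -/
theorem chart_comp_eq {T : V →ₗ[F] V} {i : ℕ} {A A' : D.Y ≃ₗ[F] D.Y}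
    (hK : ∀ y, A' y ∈ LinearMap.ker (D.blockC (D.tau i)) → y ∈ LinearMap.ker (D.blockC T)) :
    D.chart T i A = D.chart T i A' ∘ₗ Matrix.toLin' ((LinearMap.toMatrix D.y D.y
      (A.symm ≪≫ₗ A' : D.Y →ₗ[F] D.Y)).toSquareBlockProp fun k => (k : ℕ) < i) := by
  refine LinearMap.ext fun t => ?_
  refine (Submodule.Quotient.eq _).2 (hK _ (mem_ker_blockC_tau D fun j hj => ?_))
  simp only [LinearMap.comp_apply, LinearEquiv.coe_coe, map_sub, LinearEquiv.apply_symm_apply,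
    Finsupp.sub_apply]
  rw [D.repr_spanY i _ ⟨j, hj⟩, Matrix.toLin'_apply, spanY_apply]
  simp only [Matrix.mulVec, dotProduct, Matrix.toSquareBlockProp_def, Matrix.of_apply,
    LinearMap.toMatrix_apply, map_sum, map_smul, Finsupp.finsetSum_apply, Finsupp.smul_apply,
    smul_eq_mul]
  rw [sub_eq_zero]
  exact Finset.sum_congr rfl fun k _ => mul_comm _ _

theorem map_chart_eq_smul (ψ : AddChar F Circle) {T : V →ₗ[F] V} {i : ℕ} {A A' : D.Y ≃ₗ[F] D.Y}
    {M : Matrix {k : Fin n // (k : ℕ) < i} {k : Fin n // (k : ℕ) < i} F} (hM : M.det ≠ 0)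
    (h : D.chart T i A = D.chart T i A' ∘ₗ Matrix.toLin' M) :
    (Measure.pi fun _ => selfDualMeasure ψ).map (D.chart T i A) =
      ENNReal.ofReal (normAbs M.det)⁻¹ •
        (Measure.pi fun _ => selfDualMeasure ψ).map (D.chart T i A') := by
  rw [h, LinearMap.coe_comp, ← Measure.map_map (D.measurable_chart _ _ _) (measurable_toLin' _),
    map_matrix_pi (fun a ha => map_mul_left_selfDualMeasure ψ ha) hM, Measure.map_smul]

theorem det_ne_zero (A : D.Y ≃ₗ[F] D.Y) : LinearMap.det (A : D.Y →ₗ[F] D.Y) ≠ 0 :=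
  (LinearEquiv.isUnit_det' A).ne_zero

theorem det_trans (A B : D.Y ≃ₗ[F] D.Y) : LinearMap.det (A ≪≫ₗ B : D.Y →ₗ[F] D.Y) =
    LinearMap.det (A : D.Y →ₗ[F] D.Y) * LinearMap.det (B : D.Y →ₗ[F] D.Y) := by
  rw [mul_comm]
  exact LinearMap.det_comp _ _

theorem det_symm (A : D.Y ≃ₗ[F] D.Y) :
    LinearMap.det (A.symm : D.Y →ₗ[F] D.Y) = (LinearMap.det (A : D.Y →ₗ[F] D.Y))⁻¹ :=
  eq_inv_of_mul_eq_one_left (LinearEquiv.det_symm_mul_det A)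

/-- The measure does not depend on the factorization. -/
theorem Factorization.measure_eq_measure (ψ : AddChar F Circle) {g : Sp ω}
    (f f' : D.Factorization g) : f.measure ψ = f'.measure ψ := by
  rw [f.measure_eq, f'.measure_eq]
  set i := Module.finrank F (D.YQuot ((g : V ≃ₗ[F] V) : V →ₗ[F] V)) with hi
  -- As right operators put `c = p₁⁻¹ p₁'` and `d = p₂ p₂'⁻¹`; equating the two factorizations gives
  -- `c τ_i = τ_i d`.
  have hc := mul_mem_parabolic f'.mem₁ (inv_mem_parabolic f.mem₁)
  have hd := mul_mem_parabolic (inv_mem_parabolic f'.mem₂) f.mem₂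
  have h : ∀ y : D.Y, ((f'.p₂⁻¹ * f.p₂ : Sp ω) : V ≃ₗ[F] V) (D.tau i y) =
      D.tau i (((f'.p₁ * f.p₁⁻¹ : Sp ω) : V ≃ₗ[F] V) y) := by
    intro y
    have e := LinearMap.congr_fun f.eq ((f.p₁ : V ≃ₗ[F] V).symm y)
    have e' := LinearMap.congr_fun f'.eq ((f.p₁ : V ≃ₗ[F] V).symm y)
    simp only [LinearEquiv.coe_coe, LinearMap.comp_apply, LinearEquiv.apply_symm_apply] at e e'
    change (f'.p₂ : V ≃ₗ[F] V).symm ((f.p₂ : V ≃ₗ[F] V) (D.tau i y)) =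
      D.tau i ((f'.p₁ : V ≃ₗ[F] V) ((f.p₁ : V ≃ₗ[F] V).symm y))
    rw [LinearEquiv.symm_apply_eq, ← e']
    exact e.symm
  have hdet := D.det_sq_mul_det_restrictY hc hd h
  have hM : ((D.matrixY hc).toSquareBlockProp fun k => (k : ℕ) < i).det ≠ 0 := by
    intro h0
    rw [h0, zero_pow two_ne_zero, zero_mul] at hdet
    exact det_ne_zero _ hdet.symm
  have hchart := chart_comp_eq (T := ((g : V ≃ₗ[F] V) : V →ₗ[F] V)) (i := i)
    (A := restrictY f.mem₁) (A' := restrictY f'.mem₁) (fun y hy => by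
      have e' := LinearMap.congr_fun f'.eq (y : V)
      rw [mem_ker_blockC_iff] at hy ⊢
      rw [e']
      exact (apply_mem_Y_iff f'.mem₂).2 hy)
  rw [chartMeasure, chartMeasure, map_chart_eq_smul ψ hM hchart, smul_smul]
  congr 1
  -- The two normalizing determinants differ by the square of the Jacobian of the chart change, so
  -- the exponent `-1/2` exactly compensates that Jacobian.
  have key : ((D.matrixY hc).toSquareBlockProp fun k => (k : ℕ) < i).det ^ 2 *
      LinearMap.det (restrictY f.mem₁ ≪≫ₗ restrictY f.mem₂ : D.Y →ₗ[F] D.Y) =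
        LinearMap.det (restrictY f'.mem₁ ≪≫ₗ restrictY f'.mem₂ : D.Y →ₗ[F] D.Y) := by
    rw [restrictY_mul D f'.mem₁ (inv_mem_parabolic f.mem₁),
      restrictY_mul D (inv_mem_parabolic f'.mem₂) f.mem₂, restrictY_inv D f.mem₁,
      restrictY_inv D f'.mem₂, det_trans, det_trans, det_symm, det_symm] at hdet
    rw [det_trans, det_trans]
    have h1 := det_ne_zero (restrictY f.mem₁)
    have h2 := det_ne_zero (restrictY f'.mem₂)
    field_simp at hdet
    linear_combination hdet
  have hb := normAbs_pos (det_ne_zero (restrictY f.mem₁ ≪≫ₗ restrictY f.mem₂))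
  rw [← ENNReal.ofReal_mul (Real.rpow_nonneg hb.le _)]
  congr 1
  refine rpow_neg_half_mul_inv (normAbs_pos hM) ?_ hb
  rw [← key, normAbs_mul, normAbs_pow]

variable (D) in
theorem normalizedMeasure_eq (ψ : AddChar F Circle) {g : Sp ω} (f : D.Factorization g) :
    D.normalizedMeasure ψ g = f.measure ψ := by
  have h : Nonempty (D.Factorization g) := ⟨f⟩
  rw [normalizedMeasure, dif_pos h]
  exact Factorization.measure_eq_measure ψ _ _

variable (D)

/-- With `m` chart coordinates, `|s|^(m/2)` from the self-dual measures times `|s|^(-m)` from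
scaling equals `|s|^(-m/2)` from the determinant of the conjugated factorization. -/
theorem map_scaleYQuot_normalizedMeasure (hω : ω.IsAlt) (ψ : AddChar F Circle) (s : Fˣ) (g : Sp ω) :
    (D.normalizedMeasure (ψ.mulShift (s : F)) g).map (D.scaleYQuot s g) =
      D.normalizedMeasure ψ (D.conjSimilitude s g) := by
  by_cases hg : Nonempty (D.Factorization g)
  · obtain ⟨f⟩ := hg
    set i := Module.finrank F (D.YQuot ((g : V ≃ₗ[F] V) : V →ₗ[F] V)) with hi
    have hmeas : Measurable (D.scaleYQuot s g) :=
      (D.homeomorphYQuot (D.scaleYQuot s g)).continuous.measurable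
    have hs := normAbs_pos s.ne_zero
    have hdiag : ((Matrix.diagonal fun _ => (s : F) :
        Matrix {k : Fin n // (k : ℕ) < i} {k : Fin n // (k : ℕ) < i} F)).det =
          (s : F) ^ Fintype.card {k : Fin n // (k : ℕ) < i} := by
      rw [Matrix.det_diagonal, Finset.prod_const, Finset.card_univ]
    have hchart : ⇑(D.scaleYQuot s g) ∘ D.chart _ i (restrictY f.mem₁) =
        D.chart ((D.conjSimilitude s g : V ≃ₗ[F] V) : V →ₗ[F] V) i (restrictY f.mem₁) ∘
          Matrix.toLin' (Matrix.diagonal fun _ => (s : F)) := by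
      ext t
      have ht : Matrix.toLin' (Matrix.diagonal fun _ => (s : F)) t = (s : F) • t := by
        ext k
        simp [Matrix.diagonal_toLin']
      rw [Function.comp_apply, Function.comp_apply, ht, map_smul]
      rfl
    have hb := normAbs_pos (det_ne_zero (restrictY f.mem₁ ≪≫ₗ restrictY f.mem₂))
    rw [D.normalizedMeasure_eq _ f, D.normalizedMeasure_eq _ (f.conjSimilitude hω s),
      Factorization.measure_eq, Factorization.measure_eq, finrank_YQuot_conjSimilitude, ← hi,
      chartMeasure, chartMeasure, Measure.map_smul, Measure.map_map hmeas (D.measurable_chart _ _ _),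
      hchart, ← Measure.map_map (D.measurable_chart _ _ _) (measurable_toLin' _)]
    rw [pi_eq_pow_smul (selfDualMeasure_mulShift ψ s), Measure.map_smul, map_matrix_pi
        (fun a ha => map_mul_left_selfDualMeasure ψ ha) (by rw [hdiag]; exact pow_ne_zero _ s.ne_zero),
      hdiag, Measure.map_smul, Measure.map_smul, smul_smul, smul_smul]
    have hA : D.restrictY (f.conjSimilitude hω s).mem₁ = D.restrictY f.mem₁ :=
      D.restrictY_conjSimilitude s f.mem₁
    have hB : D.restrictY (f.conjSimilitude hω s).mem₂ =
        D.restrictY (D.diagonal_mem_parabolic hω (tauTwist s i)) ≪≫ₗ D.restrictY f.mem₂ := by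
      rw [← D.restrictY_conjSimilitude s f.mem₂]
      rfl
    have hdet : normAbs (LinearMap.det (D.restrictY (f.conjSimilitude hω s).mem₁ ≪≫ₗ
        D.restrictY (f.conjSimilitude hω s).mem₂ : D.Y →ₗ[F] D.Y)) =
          normAbs (s : F) ^ Fintype.card {k : Fin n // (k : ℕ) < i} *
            normAbs (LinearMap.det (restrictY f.mem₁ ≪≫ₗ restrictY f.mem₂ : D.Y →ₗ[F] D.Y)) := by
      rw [hA, hB, det_trans, det_trans, det_restrictY_diagonal, prod_tauTwist, det_trans,
        ← normAbs_pow, ← normAbs_mul, mul_left_comm]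
    rw [hdet, hA, normAbs_pow]
    congr 1
    rw [← ENNReal.ofReal_pow (Real.rpow_nonneg hs.le _),
      ← ENNReal.ofReal_mul (Real.rpow_nonneg hb.le _), ← ENNReal.ofReal_mul (by positivity)]
    exact congrArg _ (rpow_neg_half_mul_pow_mul_inv hs hb _)
  -- Conjugating back by `s⁻¹` would factor `g`; hence both measures are the default `0`.
  · have hg' : ¬ Nonempty (D.Factorization (D.conjSimilitude s g)) := fun ⟨f⟩ =>
      hg ⟨D.conjSimilitude_inv_conjSimilitude s g ▸ f.conjSimilitude hω s⁻¹⟩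
    rw [normalizedMeasure, normalizedMeasure, dif_neg hg, dif_neg hg', Measure.map_zero]

end Measures

/-! ### Blocks of the conjugate and the integrand -/

section Blocks

variable {F : Type*} [Field F] {V : Type*} [AddCommGroup V] [Module F V]
  {ω : V →ₗ[F] V →ₗ[F] F} {n : ℕ} (D : Polarization ω n) (s : Fˣ) (g : Sp ω)

theorem blockA_conjSimilitude (x : D.X) :
    D.blockA ((D.conjSimilitude s g : V ≃ₗ[F] V) : V →ₗ[F] V) x =
      D.blockA ((g : V ≃ₗ[F] V) : V →ₗ[F] V) x := by
  change D.toX ((D.conjSimilitude s g : V ≃ₗ[F] V) x) = D.toX ((g : V ≃ₗ[F] V) x)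
  rw [conjSimilitude_apply_coe_X, toX_similitude]

theorem blockB_conjSimilitude (x : D.X) :
    D.blockB ((D.conjSimilitude s g : V ≃ₗ[F] V) : V →ₗ[F] V) x =
      (s : F) • D.blockB ((g : V ≃ₗ[F] V) : V →ₗ[F] V) x := by
  change D.toY ((D.conjSimilitude s g : V ≃ₗ[F] V) x) = (s : F) • D.toY ((g : V ≃ₗ[F] V) x)
  rw [conjSimilitude_apply_coe_X, toY_similitude]

theorem blockC_conjSimilitude (y : D.Y) :
    D.blockC ((D.conjSimilitude s g : V ≃ₗ[F] V) : V →ₗ[F] V) ((s : F) • y) =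
      D.blockC ((g : V ≃ₗ[F] V) : V →ₗ[F] V) y := by
  rw [map_smul]
  change (s : F) • D.toX ((D.conjSimilitude s g : V ≃ₗ[F] V) y) = D.toX ((g : V ≃ₗ[F] V) y)
  rw [conjSimilitude_apply_coe_Y, map_smul, toX_similitude, smul_smul, Units.mul_inv, one_smul]

theorem blockD_conjSimilitude (y : D.Y) :
    D.blockD ((D.conjSimilitude s g : V ≃ₗ[F] V) : V →ₗ[F] V) ((s : F) • y) =
      (s : F) • D.blockD ((g : V ≃ₗ[F] V) : V →ₗ[F] V) y := by
  rw [map_smul]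
  change (s : F) • D.toY ((D.conjSimilitude s g : V ≃ₗ[F] V) y) =
    (s : F) • D.toY ((g : V ≃ₗ[F] V) y)
  rw [conjSimilitude_apply_coe_Y, map_smul, toY_similitude, smul_smul (s⁻¹ : Fˣ).val,
    Units.inv_mul, one_smul]

end Blocks

section Weil

variable {F : Type*} [Field F] [ValuativeRel F] [TopologicalSpace F] [IsNonarchimedeanLocalField F]
  [MeasurableSpace F] {V : Type*} [AddCommGroup V] [Module F V] [TopologicalSpace V]
  {ω : V →ₗ[F] V →ₗ[F] F} {n : ℕ} (D : Polarization ω n)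

/-- Each term of the exponent has exactly one factor from `b` or `d`, hence picks up exactly one
`s`; the argument of `φ` is unchanged. -/
theorem preIntegrand_conjSimilitude (ψ : AddChar F Circle) (s : Fˣ) (g : Sp ω) (φ : D.X → ℂ)
    (x : D.X) (y : D.Y) :
    D.preIntegrand ψ (D.conjSimilitude s g) φ x ((s : F) • y) =
      D.preIntegrand (ψ.mulShift (s : F)) g φ x y := by
  simp only [preIntegrand, blockA_conjSimilitude, blockB_conjSimilitude, blockC_conjSimilitude,
    blockD_conjSimilitude]
  simp only [AddChar.mulShift_apply, Submodule.coe_smul, map_smul,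
    LinearMap.smul_apply, smul_eq_mul]
  congr 4
  ring

theorem integrand_conjSimilitude (ψ : AddChar F Circle) (s : Fˣ) (g : Sp ω) (φ : D.X → ℂ)
    (x : D.X) (y : D.YQuot ((g : V ≃ₗ[F] V) : V →ₗ[F] V)) :
    D.integrand ψ (D.conjSimilitude s g) φ x (D.scaleYQuot s g y) =
      D.integrand (ψ.mulShift (s : F)) g φ x y := by
  obtain ⟨y, rfl⟩ := Submodule.Quotient.mk_surjective _ y
  exact D.preIntegrand_conjSimilitude ψ s g φ x y

end Weil

end Polarization

end WeilRep

open WeilRep in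
theorem proposition7 {F : Type*} [Field F] [ValuativeRel F] [TopologicalSpace F]
    [IsNonarchimedeanLocalField F] [MeasurableSpace F] [BorelSpace F]
    (hF : ringChar 𝓀[F] ≠ 2)
    {V : Type*} [AddCommGroup V] [Module F V] [TopologicalSpace V] [IsModuleTopology F V]
    (ω : V →ₗ[F] V →ₗ[F] F) (hω : ω.IsAlt) (hω' : ω.Nondegenerate)
    {n : ℕ} (D : Polarization ω n)
    (ψ : AddChar F Circle) (hψ : Continuous ψ) (hψ' : ψ ≠ 1) (s : Fˣ) (g : Sp ω) :
    D.weil ψ (D.conjSimilitude s g) = D.weil (ψ.mulShift (s : F)) g := by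
  funext φ x
  have he : MeasurableEmbedding (D.scaleYQuot s g) :=
    (D.homeomorphYQuot (D.scaleYQuot s g)).measurableEmbedding
  -- This is the substitution `y ↦ sy`; along a measurable embedding it requires no measurability or
  -- integrability of the integrand.
  rw [Polarization.weil, Polarization.weil, ← D.map_scaleYQuot_normalizedMeasure hω ψ s g,
    he.integral_map]
  simp only [Polarization.integrand_conjSimilitude]
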